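/- Let $(M,g)$ be a compact smooth Riemannian manifold without boundary, of dimension $n$ (not necessarily connected or orientable). Let $\nabla f$ denote the gradient of a smooth function $f$, let $\nabla^2 f$ denote its Hessian, regarded as the endomorphism $X\mapsto\nabla_X(\nabla f)$ of $TM$ with $\nabla_X$ the Levi-Civita connection, let $|A|^2=\operatorname{tr}(A^{\dagger}A)$ for an endomorphism $A$ of a tangent space with $g$-adjoint $A^{\dagger}$ (the squared Frobenius norm in an orthonormal frame), and let $\mathrm{dVol}_g$ be the Riemannian volume measure. Then there is a constant $C>0$, depending only on $(M,g)$, such that for every smooth function $u\colon M\to(0,\infty)$ the functions $|\nabla u|^4/u^3$ and $u\,|\nabla^2\log u|^2$ are integrable on $M$ and $$\int_M \frac{|\nabla u|^4}{u^3}\,\mathrm{dVol}_g\;\le\; C\int_M u\,|\nabla^2\log u|^2\,\mathrm{dVol}_g .$$ -/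

import Mathlib

open Bundle MeasureTheory
open scoped Manifold ContDiff

noncomputable section

namespace RiemannianGeometry

set_option linter.unusedSectionVars false

section Connection

variable {E : Type*} [NormedAddCommGroup E] [NormedSpace ℝ E]
  {H : Type*} [TopologicalSpace H] {I : ModelWithCorners ℝ E H}
  {M : Type*} [TopologicalSpace M] [ChartedSpace H M]

instance finiteDimensional_tangentSpace [FiniteDimensional ℝ E] (x : M) :
    FiniteDimensional ℝ (TangentSpace I x) :=
  inferInstanceAs (FiniteDimensional ℝ E)

variable [RiemannianBundle (fun x : M ↦ TangentSpace I x)]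

instance completeSpace_tangentSpace [FiniteDimensional ℝ E] (x : M) :
    CompleteSpace (TangentSpace I x) :=
  FiniteDimensional.complete ℝ _

variable (I) in
/-- The Koszul expression: for differentiable fields it equals `2 ⟪∇_X Y, Z⟫` at `x`. -/
def koszul (X Y Z : Π x : M, TangentSpace I x) (x : M) : ℝ :=
  mvfderiv I (fun p ↦ inner ℝ (Y p) (Z p)) x (X x)
    + mvfderiv I (fun p ↦ inner ℝ (Z p) (X p)) x (Y x)
    - mvfderiv I (fun p ↦ inner ℝ (X p) (Y p)) x (Z x)
    + inner ℝ (VectorField.mlieBracket I X Y x) (Z x)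
    - inner ℝ (VectorField.mlieBracket I Y Z x) (X x)
    + inner ℝ (VectorField.mlieBracket I Z X x) (Y x)

variable {x : M} {X X' Y Y' Z Z' : Π x : M, TangentSpace I x} {f : M → ℝ}

lemma inner_fun_comm (X Y : Π x : M, TangentSpace I x) :
    (fun p ↦ inner ℝ (X p) (Y p)) = (fun p ↦ inner ℝ (Y p) (X p)) :=
  funext fun _ ↦ real_inner_comm _ _

variable [IsManifold I ∞ M] [IsContMDiffRiemannianBundle I ∞ E (fun x : M ↦ TangentSpace I x)]

lemma mdifferentiableAt_inner (hX : MDiffAt (T% X) x) (hY : MDiffAt (T% Y) x) :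
    MDiffAt (fun p ↦ inner ℝ (X p) (Y p)) x :=
  MDifferentiableAt.inner_bundle (E := fun x : M ↦ TangentSpace I x) hX hY

lemma mvfderiv_inner_add (hX : MDiffAt (T% X) x) (hX' : MDiffAt (T% X') x)
    (hZ : MDiffAt (T% Z) x) :
    mvfderiv I (fun p ↦ inner ℝ ((X + X') p) (Z p)) x
      = mvfderiv I (fun p ↦ inner ℝ (X p) (Z p)) x + mvfderiv I (fun p ↦ inner ℝ (X' p) (Z p)) x := by
  rw [← mvfderiv_add (mdifferentiableAt_inner hX hZ) (mdifferentiableAt_inner hX' hZ)]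
  congr 1
  ext p
  simp [inner_add_left]

lemma mvfderiv_inner_smul (hf : MDiffAt f x) (hX : MDiffAt (T% X) x)
    (hZ : MDiffAt (T% Z) x) (v : TangentSpace I x) :
    mvfderiv I (fun p ↦ inner ℝ ((f • X) p) (Z p)) x v
      = f x * mvfderiv I (fun p ↦ inner ℝ (X p) (Z p)) x v
        + mvfderiv I f x v * inner ℝ (X x) (Z x) := by
  have h : (fun p ↦ inner ℝ ((f • X) p) (Z p)) = f * (fun p ↦ inner ℝ (X p) (Z p)) := by
    ext p
    simp [inner_smul_left]
  rw [h, mvfderiv_mul hf (mdifferentiableAt_inner hX hZ)]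
  simp
  ring

variable [FiniteDimensional ℝ E]

lemma koszul_add_left (hX : MDiffAt (T% X) x) (hX' : MDiffAt (T% X') x)
    (hY : MDiffAt (T% Y) x) (hZ : MDiffAt (T% Z) x) :
    koszul I (X + X') Y Z x = koszul I X Y Z x + koszul I X' Y Z x := by
  have := FiniteDimensional.complete ℝ E
  simp only [koszul]
  rw [inner_fun_comm Z (X + X'), inner_fun_comm Z X, inner_fun_comm Z X',
    mvfderiv_inner_add hX hX' hZ, mvfderiv_inner_add hX hX' hY,
    VectorField.mlieBracket_add_left hX hX', VectorField.mlieBracket_add_right hX hX']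
  simp [inner_add_left, inner_add_right]
  ring

lemma koszul_smul_left (hf : MDiffAt f x) (hX : MDiffAt (T% X) x)
    (hY : MDiffAt (T% Y) x) (hZ : MDiffAt (T% Z) x) :
    koszul I (f • X) Y Z x = f x * koszul I X Y Z x := by
  have := FiniteDimensional.complete ℝ E
  simp only [koszul]
  rw [inner_fun_comm Z (f • X), inner_fun_comm Z X,
    mvfderiv_inner_smul hf hX hZ, mvfderiv_inner_smul hf hX hY,
    VectorField.mlieBracket_smul_left hf hX, VectorField.mlieBracket_smul_right hf hX]
  simp [inner_add_left, inner_smul_left, inner_smul_right, real_inner_comm]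
  ring

lemma koszul_add_right (hX : MDiffAt (T% X) x) (hY : MDiffAt (T% Y) x)
    (hZ : MDiffAt (T% Z) x) (hZ' : MDiffAt (T% Z') x) :
    koszul I X Y (Z + Z') x = koszul I X Y Z x + koszul I X Y Z' x := by
  have := FiniteDimensional.complete ℝ E
  simp only [koszul]
  rw [inner_fun_comm Y (Z + Z'), inner_fun_comm Y Z, inner_fun_comm Y Z',
    mvfderiv_inner_add hZ hZ' hX, mvfderiv_inner_add hZ hZ' hY,
    VectorField.mlieBracket_add_left hZ hZ', VectorField.mlieBracket_add_right hZ hZ']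
  simp [inner_add_left, inner_add_right]
  ring

lemma koszul_smul_right (hf : MDiffAt f x) (hX : MDiffAt (T% X) x)
    (hY : MDiffAt (T% Y) x) (hZ : MDiffAt (T% Z) x) :
    koszul I X Y (f • Z) x = f x * koszul I X Y Z x := by
  have := FiniteDimensional.complete ℝ E
  simp only [koszul]
  rw [inner_fun_comm Y (f • Z), inner_fun_comm Y Z,
    mvfderiv_inner_smul hf hZ hX, mvfderiv_inner_smul hf hZ hY,
    VectorField.mlieBracket_smul_left hf hZ, VectorField.mlieBracket_smul_right hf hZ]
  simp [inner_add_left, inner_smul_left, inner_smul_right, real_inner_comm]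
  ring

lemma koszul_add_mid (hX : MDiffAt (T% X) x) (hY : MDiffAt (T% Y) x)
    (hY' : MDiffAt (T% Y') x) (hZ : MDiffAt (T% Z) x) :
    koszul I X (Y + Y') Z x = koszul I X Y Z x + koszul I X Y' Z x := by
  have := FiniteDimensional.complete ℝ E
  simp only [koszul]
  rw [inner_fun_comm X (Y + Y'), inner_fun_comm X Y, inner_fun_comm X Y',
    mvfderiv_inner_add hY hY' hX, mvfderiv_inner_add hY hY' hZ,
    VectorField.mlieBracket_add_left hY hY', VectorField.mlieBracket_add_right hY hY']
  simp [inner_add_left, inner_add_right]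
  ring

lemma koszul_smul_mid (hf : MDiffAt f x) (hX : MDiffAt (T% X) x)
    (hY : MDiffAt (T% Y) x) (hZ : MDiffAt (T% Z) x) :
    koszul I X (f • Y) Z x
      = f x * koszul I X Y Z x + 2 * (mvfderiv I f x (X x) * inner ℝ (Y x) (Z x)) := by
  have := FiniteDimensional.complete ℝ E
  simp only [koszul]
  rw [inner_fun_comm X (f • Y), inner_fun_comm X Y,
    mvfderiv_inner_smul hf hY hX, mvfderiv_inner_smul hf hY hZ,
    VectorField.mlieBracket_smul_left hf hY, VectorField.mlieBracket_smul_right hf hY]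
  simp [inner_add_left, inner_smul_left, inner_smul_right, real_inner_comm]
  ring

/-- The Koszul form `(v, w) ↦ 2 ⟪∇_v Y, w⟫` of a vector field `Y` differentiable at `x`. -/
def koszulForm (Y : Π x : M, TangentSpace I x) (x : M) (hY : MDiffAt (T% Y) x) :
    TangentSpace I x →L[ℝ] TangentSpace I x →L[ℝ] ℝ :=
  TensorialAt.mkHom₂ (I := I) (F := E) (F' := E) (fun X Z ↦ koszul I X Y Z x) x
    (fun _ hZ ↦ ⟨fun hf hX ↦ koszul_smul_left hf hX hY hZ,
      fun hX hX' ↦ koszul_add_left hX hX' hY hZ⟩)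
    (fun _ hX ↦ ⟨fun hf hZ ↦ koszul_smul_right hf hX hY hZ,
      fun hZ hZ' ↦ koszul_add_right hX hY hZ hZ'⟩)

lemma koszulForm_apply (hX : MDiffAt (T% X) x) (hY : MDiffAt (T% Y) x) (hZ : MDiffAt (T% Z) x) :
    koszulForm Y x hY (X x) (Z x) = koszul I X Y Z x :=
  TensorialAt.mkHom₂_apply (I := I) (F := E) (F' := E) _ _ hX hZ

open Classical in
/-- The vector `∇_v Y` at `x`, as a function of `v`, determined by
`⟪∇_v Y, w⟫ = (koszulForm Y x) v w / 2` for all `w`. It is `0` where `Y` is not differentiable. -/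
def leviCivitaFun (Y : Π x : M, TangentSpace I x) (x : M) :
    TangentSpace I x →L[ℝ] TangentSpace I x :=
  if hY : MDiffAt (T% Y) x then
    InnerProductSpace.continuousLinearMapOfBilin ((1 / 2 : ℝ) • koszulForm Y x hY)
  else 0

lemma inner_leviCivitaFun (hX : MDiffAt (T% X) x) (hY : MDiffAt (T% Y) x)
    (hZ : MDiffAt (T% Z) x) :
    inner ℝ (leviCivitaFun Y x (X x)) (Z x) = koszul I X Y Z x / 2 := by
  rw [leviCivitaFun, dif_pos hY, InnerProductSpace.continuousLinearMapOfBilin_apply,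
    ← koszulForm_apply hX hY hZ]
  simp
  ring


lemma leviCivitaFun_ext {A B : TangentSpace I x →L[ℝ] TangentSpace I x}
    (h : ∀ X Z : Π x : M, TangentSpace I x, MDiffAt (T% X) x → MDiffAt (T% Z) x →
      inner ℝ (A (X x)) (Z x) = inner ℝ (B (X x)) (Z x)) : A = B := by
  ext1 v
  refine ext_inner_right ℝ fun w ↦ ?_
  have := h (FiberBundle.extend E v) (FiberBundle.extend E w)
    (FiberBundle.mdifferentiableAt_extend ..) (FiberBundle.mdifferentiableAt_extend ..)
  simpa using this

variable (I M) in
/-- The Levi-Civita connection of a Riemannian manifold: `leviCivita I M Y x v` is `∇_v Y` at `x`.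
It is metric (`leviCivita_metric`) and torsion-free (`leviCivita_torsionFree`). -/
def leviCivita : CovariantDerivative I E (TangentSpace I : M → Type _) where
  toFun := leviCivitaFun
  isCovariantDerivativeOnUniv :=
    { add := fun {Y Y' x} hY hY' _ ↦ by
        refine leviCivitaFun_ext fun X Z hX hZ ↦ ?_
        have hYY' : MDiffAt (T% (Y + Y')) x := mdifferentiableAt_add_section hY hY'
        rw [inner_leviCivitaFun hX hYY' hZ, koszul_add_mid hX hY hY' hZ,
          _root_.add_apply, inner_add_left, inner_leviCivitaFun hX hY hZ,
          inner_leviCivitaFun hX hY' hZ]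
        ring
      leibniz := fun {Y f x} hY hf _ ↦ by
        refine leviCivitaFun_ext fun X Z hX hZ ↦ ?_
        have hfY : MDiffAt (T% (f • Y)) x := hf.smul_section hY
        rw [inner_leviCivitaFun hX hfY hZ, koszul_smul_mid hf hX hY hZ,
          _root_.add_apply, inner_add_left, _root_.smul_apply,
          inner_smul_left, inner_leviCivitaFun hX hY hZ, ContinuousLinearMap.smulRight_apply,
          inner_smul_left]
        simp
        ring }


/-- The Levi-Civita connection is compatible with the metric. -/
lemma leviCivita_metric (hX : MDiffAt (T% X) x) (hY : MDiffAt (T% Y) x) (hZ : MDiffAt (T% Z) x) :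
    mvfderiv I (fun p ↦ inner ℝ (Y p) (Z p)) x (X x)
      = inner ℝ (leviCivita I M Y x (X x)) (Z x) + inner ℝ (Y x) (leviCivita I M Z x (X x)) := by
  have h₁ := inner_leviCivitaFun hX hY hZ
  have h₂ := inner_leviCivitaFun hX hZ hY
  change _ = inner ℝ (leviCivitaFun Y x (X x)) (Z x) + inner ℝ (Y x) (leviCivitaFun Z x (X x))
  rw [h₁, real_inner_comm, h₂, koszul, koszul, inner_fun_comm Z Y, inner_fun_comm Y X,
    inner_fun_comm Z X, VectorField.mlieBracket_swap_apply (V := Z) (W := Y),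
    VectorField.mlieBracket_swap_apply (V := Y) (W := X),
    VectorField.mlieBracket_swap_apply (V := Z) (W := X)]
  simp only [inner_neg_left]
  ring

lemma leviCivita_isMetricCompatible :
    CovariantDerivative.IsMetricCompatible (V := fun x : M ↦ TangentSpace I x) (F := E)
      (leviCivita I M) := by
  rw [CovariantDerivative.isMetricCompatible_iff]
  intro x X Y Z hX hY hZ
  exact leviCivita_metric hX hY hZ

/-- The Levi-Civita connection is torsion-free. -/
lemma leviCivita_torsionFree (hX : MDiffAt (T% X) x) (hY : MDiffAt (T% Y) x) :
    leviCivita I M Y x (X x) - leviCivita I M X x (Y x) = VectorField.mlieBracket I X Y x := by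
  refine ext_inner_right ℝ fun w ↦ ?_
  have hW : MDiffAt (T% (FiberBundle.extend E w)) x := FiberBundle.mdifferentiableAt_extend ..
  have h₁ := inner_leviCivitaFun hX hY hW
  have h₂ := inner_leviCivitaFun hY hX hW
  have hw : FiberBundle.extend E w x = w := by simp
  change inner ℝ (leviCivitaFun Y x (X x) - leviCivitaFun X x (Y x)) w = _
  generalize FiberBundle.extend E w = W at *
  subst hw
  rw [inner_sub_left, h₁, h₂, koszul, koszul, inner_fun_comm X W, inner_fun_comm W Y,
    inner_fun_comm Y X, VectorField.mlieBracket_swap_apply (V := Y) (W := X),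
    VectorField.mlieBracket_swap_apply (V := W) (W := Y),
    VectorField.mlieBracket_swap_apply (V := W) (W := X)]
  simp only [inner_neg_left]
  ring

variable (I) in
/-- The gradient of `f`: the vector field with `⟪grad f x, v⟫ = df_x(v)` for all `v`. -/
def grad (f : M → ℝ) (x : M) : TangentSpace I x :=
  (InnerProductSpace.toDual ℝ (TangentSpace I x)).symm (mvfderiv I f x)

variable (I) in
/-- The Hessian of `f` at `x`, as the endomorphism `v ↦ ∇_v (grad f)` of the tangent space, where
`∇` is the Levi-Civita connection. -/
def hessian (f : M → ℝ) (x : M) : TangentSpace I x →L[ℝ] TangentSpace I x :=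
  leviCivita I M (grad I f) x

end Connection

/-- The squared norm `|A|² = tr (A† A)` of an endomorphism of a finite-dimensional inner product
space, where `A†` is the adjoint of `A`. In an orthonormal basis it is the squared Frobenius norm of
the matrix of `A`. -/
def normSqEnd {V : Type*} [NormedAddCommGroup V] [InnerProductSpace ℝ V] [FiniteDimensional ℝ V]
    (A : V →L[ℝ] V) : ℝ :=
  LinearMap.trace ℝ V (LinearMap.adjoint (A : V →ₗ[ℝ] V) ∘ₗ (A : V →ₗ[ℝ] V))

section Volume

variable {n : ℕ} {M : Type*} [TopologicalSpace M] [ChartedSpace (EuclideanSpace ℝ (Fin n)) M]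
  [RiemannianBundle (fun x : M ↦ TangentSpace (𝓡 n) x)]

/-- The `i`-th coordinate vector field of the preferred chart at `x`, at the point with
coordinates `y`. -/
def coordVector (x : M) (y : EuclideanSpace ℝ (Fin n)) (i : Fin n) :
    TangentSpace (𝓡 n) ((extChartAt (𝓡 n) x).symm y) :=
  mfderiv 𝓘(ℝ, EuclideanSpace ℝ (Fin n)) (𝓡 n) (extChartAt (𝓡 n) x).symm y
    (EuclideanSpace.single i (1 : ℝ) : EuclideanSpace ℝ (Fin n))

/-- The matrix `(g_ij)` of the metric in the preferred chart at `x`, at the point with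
coordinates `y`. -/
def metricMatrix (x : M) (y : EuclideanSpace ℝ (Fin n)) : Matrix (Fin n) (Fin n) ℝ :=
  Matrix.of fun i j ↦ inner ℝ (coordVector x y i) (coordVector x y j)

/-- The measure `√(det g_ij) dy¹ ⋯ dyⁿ` of the preferred chart at `x`, carried to `M`. It gives no
mass to the complement of the domain of the chart. -/
def chartVolume [MeasurableSpace M] (x : M) : Measure M :=
  ((volume.restrict (extChartAt (𝓡 n) x).target).withDensity
    fun y ↦ ENNReal.ofReal (√(metricMatrix x y).det)).map (extChartAt (𝓡 n) x).symm

variable (n M) in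
/-- The Riemannian volume measure `dVol_g`: the least measure that dominates
`√(det g_ij) dy¹ ⋯ dyⁿ` in each chart. Since by the change of variables formula these chart measures
agree on the overlaps of the charts, it equals `√(det g_ij) dy¹ ⋯ dyⁿ` on the domain of each
chart. -/
def riemannianVolume [MeasurableSpace M] : Measure M :=
  ⨆ x : M, chartVolume (n := n) x

end Volume

end RiemannianGeometry

end

/-! Put `f = log u`. Then `∇u = u ∇f`, so the left integrand is `u |∇f|⁴`. Since also `du(∇f) = u
|∇f|²`, the field `u |∇f|² ∇f` has divergence `u (|∇f|⁴ + 2 ⟪∇²f ∇f, ∇f⟫ + |∇f|² Δf)`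
(`divGrad_mul_normSq_grad_log`), whose integral over a closed manifold is zero. Both Hessian terms
are quadratic in `∇f` and linear in `∇²f`: `|⟪∇²f ∇f, ∇f⟫| ≤ |∇²f| |∇f|²` and `(Δf)² ≤ n |∇²f|²`.
Young's inequality bounds them by `|∇f|⁴ / 2 + (4 + n) |∇²f|²` (`neg_hessian_terms_le`), and
absorbing the first summand on the left gives `C = 2 (4 + n)`, which depends on the dimension alone.

Most of the work is the divergence theorem `integral_divGrad_eq_zero` for fields `w ∇f`. In a chart
with metric matrix `G`, `√(det G) div (w ∇f)` is a sum of partial derivatives `∂ₖ (w √(det G) fᵏ)`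
(`sqrt_det_mul_divergence`): by Jacobi's formula, `∂ₖ √(det G)` is exactly what the contracted
Christoffel symbols contribute to the Laplacian. On a chart domain the volume measure is `√(det G)
dy` (`restrict_riemannianVolume`), so the integral vanishes when `w` is supported in one chart, and
a partition of unity handles general `w`. The same coordinate formulas show that the integrands are
continuous, hence integrable on a compact manifold. -/

open Bundle MeasureTheory
open scoped Manifold ContDiff

noncomputable section

namespace RiemannianGeometry

set_option linter.unusedSectionVars false

/-! ### Traces and Frobenius norms of endomorphisms in arbitrary and orthonormal bases. -/

section LinearAlgebra

variable {ι : Type*} [Fintype ι] [DecidableEq ι]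
  {V : Type*} [NormedAddCommGroup V] [InnerProductSpace ℝ V] [FiniteDimensional ℝ V]

/-- The Gram matrix of a basis of a real inner product space is positive definite. -/
lemma posDef_gram_basis (b : Module.Basis ι ℝ V) : (Matrix.gram ℝ b).PosDef :=
  Matrix.posDef_gram_of_linearIndependent b.linearIndependent

/-- Pairing the expansion of `A (b j)` with `b i` multiplies the matrix of `A` by the Gram matrix.
Coordinate frames are not orthonormal, so traces in them need this correction. -/
lemma toMatrix_eq_inv_gram_mul (b : Module.Basis ι ℝ V) (A : V →ₗ[ℝ] V) :
    LinearMap.toMatrix b b A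
      = (Matrix.gram ℝ b)⁻¹ * Matrix.of (fun i j ↦ inner ℝ (b i) (A (b j))) := by
  have hdet : IsUnit (Matrix.gram ℝ b).det := (posDef_gram_basis b).det_pos.ne'.isUnit
  have h : Matrix.of (fun i j ↦ inner ℝ (b i) (A (b j)))
      = Matrix.gram ℝ b * LinearMap.toMatrix b b A := by
    ext i j
    rw [Matrix.of_apply, Matrix.mul_apply]
    conv_lhs => rw [← b.sum_repr (A (b j))]
    rw [inner_sum]
    refine Finset.sum_congr rfl fun k _ ↦ ?_
    rw [inner_smul_right, Matrix.gram_apply, LinearMap.toMatrix_apply]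
    ring
  rw [h, Matrix.nonsing_inv_mul_cancel_left _ _ hdet]

lemma trace_eq_trace_inv_gram_mul (b : Module.Basis ι ℝ V) (A : V →ₗ[ℝ] V) :
    LinearMap.trace ℝ V A
      = ((Matrix.gram ℝ b)⁻¹ * Matrix.of (fun i j ↦ inner ℝ (b i) (A (b j)))).trace := by
  rw [LinearMap.trace_eq_matrix_trace ℝ b, toMatrix_eq_inv_gram_mul]

lemma normSqEnd_eq_trace (b : Module.Basis ι ℝ V) (A : V →L[ℝ] V) :
    normSqEnd A
      = ((Matrix.gram ℝ b)⁻¹ * (Matrix.of (fun i j ↦ inner ℝ (b i) (A (b j)))).transpose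
        * ((Matrix.gram ℝ b)⁻¹ * Matrix.of (fun i j ↦ inner ℝ (b i) (A (b j))))).trace := by
  rw [normSqEnd, LinearMap.trace_eq_matrix_trace ℝ b, LinearMap.toMatrix_comp b b b,
    toMatrix_eq_inv_gram_mul, toMatrix_eq_inv_gram_mul]
  congr 4
  ext i j
  simp [LinearMap.adjoint_inner_right, real_inner_comm]

lemma normSqEnd_eq_sum (b : OrthonormalBasis ι ℝ V) (A : V →L[ℝ] V) :
    normSqEnd A = ∑ i, ‖A (b i)‖ ^ 2 := by
  rw [normSqEnd, LinearMap.trace_eq_sum_inner _ b]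
  simp [LinearMap.adjoint_inner_right]

lemma normSqEnd_nonneg (A : V →L[ℝ] V) : 0 ≤ normSqEnd A := by
  rw [normSqEnd_eq_sum (stdOrthonormalBasis ℝ V)]
  positivity

/-- Cauchy–Schwarz for the diagonal entries in an orthonormal basis. It controls the Laplacian by
the Hessian. -/
lemma sq_trace_le_finrank_mul_normSqEnd (A : V →L[ℝ] V) :
    (LinearMap.trace ℝ V (A : V →ₗ[ℝ] V)) ^ 2 ≤ Module.finrank ℝ V * normSqEnd A := by
  set b := stdOrthonormalBasis ℝ V
  rw [normSqEnd_eq_sum b, LinearMap.trace_eq_sum_inner _ b]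
  calc (∑ i, inner ℝ (b i) (A (b i))) ^ 2
      ≤ (Finset.univ : Finset (Fin (Module.finrank ℝ V))).card
          * ∑ i, (inner ℝ (b i) (A (b i))) ^ 2 := sq_sum_le_card_mul_sum_sq
    _ ≤ _ := by
      rw [Finset.card_univ, Fintype.card_fin]
      refine mul_le_mul_of_nonneg_left (Finset.sum_le_sum fun i _ ↦ ?_) (Nat.cast_nonneg _)
      rw [← sq_abs (inner ℝ _ _)]
      refine pow_le_pow_left₀ (abs_nonneg _) ?_ 2
      simpa using abs_real_inner_le_norm (b i) (A (b i))

/-- The Frobenius norm dominates the operator norm, by Cauchy–Schwarz on the expansion of `v` in an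
orthonormal basis. -/
lemma sq_inner_le_normSqEnd_mul (A : V →L[ℝ] V) (v : V) :
    (inner ℝ (A v) v) ^ 2 ≤ normSqEnd A * (‖v‖ ^ 2) ^ 2 := by
  have h : ‖A v‖ ^ 2 ≤ normSqEnd A * ‖v‖ ^ 2 := by
    set b := stdOrthonormalBasis ℝ V
    rw [normSqEnd_eq_sum b, ← b.sum_sq_norm_inner_right v]
    calc ‖A v‖ ^ 2 ≤ (∑ i, ‖A (b i)‖ * ‖inner ℝ (b i) v‖) ^ 2 := by
          gcongr
          conv_lhs => rw [← b.sum_repr' v]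
          rw [map_sum]
          refine (norm_sum_le _ _).trans (Finset.sum_le_sum fun i _ ↦ ?_)
          rw [map_smul, norm_smul, mul_comm]
      _ ≤ _ := Finset.sum_mul_sq_le_sq_mul_sq ..
  calc (inner ℝ (A v) v) ^ 2 ≤ (‖A v‖ * ‖v‖) ^ 2 := by
        rw [← sq_abs (inner ℝ _ _)]
        refine pow_le_pow_left₀ (abs_nonneg _) ?_ 2
        exact abs_real_inner_le_norm _ _
    _ = ‖A v‖ ^ 2 * ‖v‖ ^ 2 := by ring
    _ ≤ normSqEnd A * ‖v‖ ^ 2 * ‖v‖ ^ 2 := by gcongr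
    _ = _ := by ring

end LinearAlgebra

/-! ### Differentiating the determinant. -/

section Determinant

variable {ι : Type*} [Fintype ι] [DecidableEq ι]

/-- Jacobi's formula at a matrix. -/
lemma hasFDerivAt_det (A : ι → ι → ℝ) :
    HasFDerivAt (fun B : ι → ι → ℝ ↦ (Matrix.of B).det)
      (∑ i, ∑ j, (Matrix.of A).adjugate j i •
        ((ContinuousLinearMap.proj j : (ι → ℝ) →L[ℝ] ℝ).comp
          (ContinuousLinearMap.proj i : (ι → ι → ℝ) →L[ℝ] ι → ℝ))) A := by
  let F : ContinuousMultilinearMap ℝ (fun _ : ι ↦ ι → ℝ) ℝ :=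
    { (Matrix.detRowAlternating (n := ι) (R := ℝ)).toMultilinearMap with
      cont := by
        change Continuous fun B : ι → ι → ℝ ↦ (Matrix.of B).det
        exact Continuous.matrix_det (A := fun B : ι → ι → ℝ ↦ Matrix.of B) continuous_id }
  have h := F.hasFDerivAt A
  refine h.congr_fderiv ?_
  ext B
  rw [ContinuousMultilinearMap.linearDeriv_apply]
  simp only [_root_.sum_apply, _root_.smul_apply, smul_eq_mul, ContinuousLinearMap.comp_apply,
    ContinuousLinearMap.proj_apply]
  refine Finset.sum_congr rfl fun i _ ↦ ?_
  -- Multilinearity in the rows makes each term the determinant with row `i` replaced by `B i`;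
  -- Cramer's rule expands it along that row.
  change ((Matrix.of A).updateRow i (B i)).det = _
  rw [← Matrix.cramer_transpose_apply, Matrix.cramer_eq_adjugate_mulVec, Matrix.mulVec,
    dotProduct, ← Matrix.adjugate_transpose]
  simp [Matrix.transpose_apply]

lemma hasFDerivAt_det_comp {F : Type*} [NormedAddCommGroup F] [NormedSpace ℝ F]
    {A : F → Matrix ι ι ℝ} {A' : ι → ι → F →L[ℝ] ℝ} {y : F}
    (h : ∀ i j, HasFDerivAt (fun z ↦ A z i j) (A' i j) y) :
    HasFDerivAt (fun z ↦ (A z).det) (∑ i, ∑ j, (A y).adjugate j i • A' i j) y := by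
  have h₁ : HasFDerivAt (fun z i j ↦ A z i j)
      (ContinuousLinearMap.pi fun i ↦ ContinuousLinearMap.pi fun j ↦ A' i j) y :=
    hasFDerivAt_pi.2 fun i ↦ hasFDerivAt_pi.2 fun j ↦ h i j
  have h₂ := (hasFDerivAt_det (fun i j ↦ A y i j)).comp y h₁
  refine h₂.congr_fderiv ?_
  ext v
  simp [_root_.sum_apply]
  rfl

end Determinant

/-! ### Coordinate vector fields and derivatives along them. -/

section CoordinateFrame

variable {n : ℕ} {M : Type*} [TopologicalSpace M] [ChartedSpace (EuclideanSpace ℝ (Fin n)) M]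
  [IsManifold (𝓡 n) ∞ M]

lemma extChartAt_symm_mem_source {x : M} {y : EuclideanSpace ℝ (Fin n)}
    (hy : y ∈ (extChartAt (𝓡 n) x).target) :
    (extChartAt (𝓡 n) x).symm y ∈ (chartAt (EuclideanSpace ℝ (Fin n)) x).source := by
  rw [← extChartAt_source (𝓡 n)]
  exact (extChartAt (𝓡 n) x).map_target hy

/-- The `i`-th coordinate vector field of the preferred chart at `x`, as a vector field on `M`
(zero outside of the chart domain). -/
def coordFrame (x : M) (i : Fin n) (p : M) : TangentSpace (𝓡 n) p :=
  (trivializationAt (EuclideanSpace ℝ (Fin n)) (TangentSpace (𝓡 n) : M → Type _) x).symmL ℝ p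
    (EuclideanSpace.single i (1 : ℝ))

lemma isLocalFrameOn_coordFrame (x : M) :
    IsLocalFrameOn (𝓡 n) (EuclideanSpace ℝ (Fin n)) ∞ (coordFrame (n := n) x)
      (chartAt (EuclideanSpace ℝ (Fin n)) x).source := by
  have h := (trivializationAt (EuclideanSpace ℝ (Fin n)) (TangentSpace (𝓡 n) : M → Type _)
    x).isLocalFrameOn_localFrame_baseSet (𝓡 n) ∞ (EuclideanSpace.basisFun (Fin n) ℝ).toBasis
  rw [TangentBundle.trivializationAt_baseSet] at h
  refine IsLocalFrameOn.congr h fun i p hp ↦ ?_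
  have hp' : p ∈ (trivializationAt (EuclideanSpace ℝ (Fin n))
      (TangentSpace (𝓡 n) : M → Type _) x).baseSet := by
    rwa [TangentBundle.trivializationAt_baseSet]
  rw [Trivialization.localFrame_apply_of_mem_baseSet _ _ hp', Trivialization.basisAt,
    Module.Basis.map_apply, OrthonormalBasis.coe_toBasis, EuclideanSpace.basisFun_apply]
  exact congrFun (Trivialization.symm_continuousLinearEquivAt_eq (R := ℝ) _ hp')
    (EuclideanSpace.single i 1)

/-- The trivialization of the tangent bundle at `x` is, over the chart domain, the derivative of the
chart. -/
lemma mfderiv_extChartAt_coordFrame {x p : M}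
    (hp : p ∈ (chartAt (EuclideanSpace ℝ (Fin n)) x).source) (i : Fin n) :
    mfderiv (𝓡 n) 𝓘(ℝ, EuclideanSpace ℝ (Fin n)) (extChartAt (𝓡 n) x) p (coordFrame x i p)
      = (EuclideanSpace.single i (1 : ℝ) : EuclideanSpace ℝ (Fin n)) := by
  have hp' : p ∈ (trivializationAt (EuclideanSpace ℝ (Fin n))
      (TangentSpace (𝓡 n) : M → Type _) x).baseSet := by
    rwa [TangentBundle.trivializationAt_baseSet]
  have h := Trivialization.continuousLinearMapAt_symmL (R := ℝ) _ hp'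
    (EuclideanSpace.single i (1 : ℝ))
  rw [TangentBundle.continuousLinearMapAt_trivializationAt hp] at h
  exact h

lemma coordFrame_eq_inverse_mfderiv {x p : M}
    (hp : p ∈ (chartAt (EuclideanSpace ℝ (Fin n)) x).source) (i : Fin n) :
    coordFrame x i p = (mfderiv (𝓡 n) 𝓘(ℝ, EuclideanSpace ℝ (Fin n)) (extChartAt (𝓡 n) x)
      p).inverse (EuclideanSpace.single i (1 : ℝ) : EuclideanSpace ℝ (Fin n)) :=
  ((isInvertible_mfderiv_extChartAt (by rwa [extChartAt_source])).inverse_apply_eq.2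
    (mfderiv_extChartAt_coordFrame hp i).symm).symm

/-- The frame is the pullback of constant fields by the chart, pullback commutes with brackets, and
constant fields commute. This removes the bracket terms from the Koszul formula. -/
lemma mlieBracket_coordFrame {x p : M} (hp : p ∈ (chartAt (EuclideanSpace ℝ (Fin n)) x).source)
    (i j : Fin n) :
    VectorField.mlieBracket (𝓡 n) (coordFrame x i) (coordFrame x j) p = 0 := by
  set φ := extChartAt (𝓡 n) x
  let V (i : Fin n) : Π y : EuclideanSpace ℝ (Fin n),
    TangentSpace 𝓘(ℝ, EuclideanSpace ℝ (Fin n)) y :=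
    fun _ ↦ (EuclideanSpace.single i (1 : ℝ) : EuclideanSpace ℝ (Fin n))
  have hev (i : Fin n) : coordFrame x i =ᶠ[nhds p] VectorField.mpullback (𝓡 n)
      𝓘(ℝ, EuclideanSpace ℝ (Fin n)) φ (V i) := by
    filter_upwards [(chartAt (EuclideanSpace ℝ (Fin n)) x).open_source.mem_nhds hp] with q hq
    exact coordFrame_eq_inverse_mfderiv hq i
  rw [(hev i).mlieBracket_vectorField_eq (hev j)]
  have hd (i : Fin n) (y) : MDiffAt (T% (V i)) y := by
    exact (contMDiffAt_vectorSpace_iff_contDiffAt.2 contDiffAt_const).mdifferentiableAt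
      (n := 1) one_ne_zero
  have : IsManifold (𝓡 n) (minSmoothness ℝ 2) M := by
    rw [minSmoothness_of_isRCLikeNormedField]
    infer_instance
  rw [← VectorField.mpullback_mlieBracket (n := 2) (hd i _) (hd j _) _ (by simp)]
  · have h0 : VectorField.mlieBracket 𝓘(ℝ, EuclideanSpace ℝ (Fin n)) (V i) (V j) (φ p) = 0 := by
      rw [← VectorField.mlieBracketWithin_univ, VectorField.mlieBracketWithin_eq_lieBracketWithin]
      simp [V, VectorField.lieBracketWithin]
      rfl
    rw [VectorField.mpullback_apply, h0, map_zero]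
  · exact contMDiffAt_extChartAt' hp

lemma differentiableAt_comp_extChartAt_symm {F : Type*} [NormedAddCommGroup F] [NormedSpace ℝ F] {x p : M}
    (hp : p ∈ (chartAt (EuclideanSpace ℝ (Fin n)) x).source)
    {h : M → F} (hh : MDifferentiableAt (𝓡 n) 𝓘(ℝ, F) h p) :
    DifferentiableAt ℝ (h ∘ (extChartAt (𝓡 n) x).symm) (extChartAt (𝓡 n) x p) := by
  set φ := extChartAt (𝓡 n) x
  have hp' : p ∈ φ.source := by rwa [extChartAt_source]
  rw [← mdifferentiableAt_iff_differentiableAt]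
  have h₁ : MDifferentiableAt 𝓘(ℝ, EuclideanSpace ℝ (Fin n)) (𝓡 n) φ.symm (φ p) := by
    have := mdifferentiableWithinAt_extChartAt_symm (φ.map_source hp')
    rwa [ModelWithCorners.range_eq_univ, mdifferentiableWithinAt_univ] at this
  exact MDifferentiableAt.comp_of_eq _ hh h₁ (φ.left_inv hp')

/-- The target is a general `F` so that the lemma covers both real functions and a second chart,
where it yields the Jacobian of the transition map. -/
lemma mfderiv_coordFrame {F : Type*} [NormedAddCommGroup F] [NormedSpace ℝ F] {x p : M}
    (hp : p ∈ (chartAt (EuclideanSpace ℝ (Fin n)) x).source)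
    (i : Fin n) {h : M → F} (hh : MDifferentiableAt (𝓡 n) 𝓘(ℝ, F) h p) :
    mfderiv (𝓡 n) 𝓘(ℝ, F) h p (coordFrame x i p)
      = fderiv ℝ (h ∘ (extChartAt (𝓡 n) x).symm) (extChartAt (𝓡 n) x p)
      (EuclideanSpace.single i (1 : ℝ)) := by
  set φ := extChartAt (𝓡 n) x
  have hp' : p ∈ φ.source := by rwa [extChartAt_source]
  have hev : h =ᶠ[nhds p] (h ∘ φ.symm) ∘ φ := by
    filter_upwards [(isOpen_extChartAt_source x).mem_nhds hp'] with q hq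
    simp [φ.left_inv hq]
  have hφ : MDifferentiableAt (𝓡 n) 𝓘(ℝ, EuclideanSpace ℝ (Fin n)) φ p :=
    mdifferentiableAt_extChartAt hp
  have hs : MDifferentiableAt 𝓘(ℝ, EuclideanSpace ℝ (Fin n)) 𝓘(ℝ, F) (h ∘ φ.symm) (φ p) :=
    (differentiableAt_comp_extChartAt_symm hp hh).mdifferentiableAt
  rw [hev.mfderiv_eq]
  have := mfderiv_comp_apply p hs hφ (coordFrame x i p)
  rw [mfderiv_extChartAt_coordFrame hp] at this
  rw [← mfderiv_eq_fderiv]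
  exact this

/-- The derivative of `h` along the `i`-th coordinate vector field of the chart at `x`. -/
def coordDeriv (x : M) (i : Fin n) (h : M → ℝ) (p : M) : ℝ :=
  mvfderiv (𝓡 n) h p (coordFrame x i p)

lemma coordDeriv_eq_fderiv {x p : M} (hp : p ∈ (chartAt (EuclideanSpace ℝ (Fin n)) x).source)
    (i : Fin n) {h : M → ℝ} (hh : MDifferentiableAt (𝓡 n) 𝓘(ℝ, ℝ) h p) :
    coordDeriv x i h p = fderiv ℝ (h ∘ (extChartAt (𝓡 n) x).symm) (extChartAt (𝓡 n) x p)
      (EuclideanSpace.single i (1 : ℝ)) :=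
  mfderiv_coordFrame hp i hh

end CoordinateFrame

/-! ### Smoothness of coordinate derivatives and of matrix inverses. -/

section Smooth

variable {n : ℕ} {M : Type*} [TopologicalSpace M] [ChartedSpace (EuclideanSpace ℝ (Fin n)) M]
  [IsManifold (𝓡 n) ∞ M]

lemma contMDiffOn_coordDeriv {x : M} (i : Fin n) {h : M → ℝ}
    (hh : ContMDiffOn (𝓡 n) 𝓘(ℝ, ℝ) ∞ h (chartAt (EuclideanSpace ℝ (Fin n)) x).source) :
    ContMDiffOn (𝓡 n) 𝓘(ℝ, ℝ) ∞ (coordDeriv x i h)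
      (chartAt (EuclideanSpace ℝ (Fin n)) x).source := by
  set φ := extChartAt (𝓡 n) x
  have hs : (chartAt (EuclideanSpace ℝ (Fin n)) x).source = φ.source :=
    (extChartAt_source (𝓡 n) x).symm
  have h₁ : ContDiffOn ℝ ∞ (h ∘ φ.symm) φ.target := by
    rw [← contMDiffOn_iff_contDiffOn]
    refine hh.comp (contMDiffOn_extChartAt_symm x) fun y hy ↦ ?_
    rw [Set.mem_preimage, hs]
    exact φ.map_target hy
  have h₂ : ContDiffOn ℝ ∞ (fun y ↦ fderiv ℝ (h ∘ φ.symm) y (EuclideanSpace.single i (1 : ℝ)))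
      φ.target :=
    (h₁.fderiv_of_isOpen (isOpen_extChartAt_target x) (by simp)).clm_apply contDiffOn_const
  have h₃ : ContMDiffOn (𝓡 n) 𝓘(ℝ, ℝ) ∞
      ((fun y ↦ fderiv ℝ (h ∘ φ.symm) y (EuclideanSpace.single i (1 : ℝ))) ∘ φ)
      (chartAt (EuclideanSpace ℝ (Fin n)) x).source := by
    refine (contMDiffOn_iff_contDiffOn.2 h₂).comp contMDiffOn_extChartAt fun p hp ↦ ?_
    exact φ.map_source (hs ▸ hp)
  refine h₃.congr fun p hp ↦ coordDeriv_eq_fderiv hp i ?_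
  exact (hh.contMDiffAt ((chartAt _ x).open_source.mem_nhds hp)).mdifferentiableAt (by simp)

lemma contMDiffOn_det {ι : Type*} [Fintype ι] [DecidableEq ι] {A : M → Matrix ι ι ℝ} {s : Set M}
    (h : ∀ i j, ContMDiffOn (𝓡 n) 𝓘(ℝ, ℝ) ∞ (fun p ↦ A p i j) s) :
    ContMDiffOn (𝓡 n) 𝓘(ℝ, ℝ) ∞ (fun p ↦ (A p).det) s := by
  simp only [Matrix.det_apply']
  exact contMDiffOn_finsetSum fun σ _ ↦ contMDiffOn_const.mul
    (contMDiffOn_finsetProd fun i _ ↦ h _ _)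

/-- The inverse is the adjugate over the determinant, and the entries of the adjugate are themselves
determinants. -/
lemma contMDiffOn_inv {ι : Type*} [Fintype ι] [DecidableEq ι] {A : M → Matrix ι ι ℝ} {s : Set M}
    (h : ∀ i j, ContMDiffOn (𝓡 n) 𝓘(ℝ, ℝ) ∞ (fun p ↦ A p i j) s) (hA : ∀ p ∈ s, (A p).det ≠ 0)
    (i j : ι) :
    ContMDiffOn (𝓡 n) 𝓘(ℝ, ℝ) ∞ (fun p ↦ (A p)⁻¹ i j) s := by
  have h₁ : ContMDiffOn (𝓡 n) 𝓘(ℝ, ℝ) ∞ (fun p ↦ (A p).adjugate i j) s := by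
    simp only [Matrix.adjugate_apply]
    refine contMDiffOn_det fun k l ↦ ?_
    by_cases hk : k = j
    · subst hk
      simpa using contMDiffOn_const
    · simpa [Matrix.updateRow_ne hk] using h k l
  simp only [Matrix.inv_def, Matrix.smul_apply, smul_eq_mul, Ring.inverse_eq_inv']
  exact ((contMDiffOn_det h).inv₀ hA).mul h₁

end Smooth

/-! ### The metric matrix in a chart and the derivative of the Riemannian density. -/

section Metric

variable {n : ℕ} {M : Type*} [TopologicalSpace M] [ChartedSpace (EuclideanSpace ℝ (Fin n)) M]
  [RiemannianBundle (fun x : M ↦ TangentSpace (𝓡 n) x)]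
  [IsManifold (𝓡 n) ∞ M]

/-- The matrix of the metric in the coordinate frame of the preferred chart at `x`. -/
def coordGram (x p : M) : Matrix (Fin n) (Fin n) ℝ :=
  Matrix.of fun i j ↦ inner ℝ (coordFrame (n := n) x i p) (coordFrame (n := n) x j p)

lemma coordGram_eq_gram {x p : M} (hp : p ∈ (chartAt (EuclideanSpace ℝ (Fin n)) x).source) :
    coordGram (n := n) x p = Matrix.gram ℝ ((isLocalFrameOn_coordFrame (n := n) x).toBasisAt hp) := by
  ext i j
  simp [coordGram, Matrix.gram_apply]

lemma coordGram_symm (x p : M) (i j : Fin n) : coordGram x p i j = coordGram x p j i := by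
  simp only [coordGram, Matrix.of_apply, real_inner_comm]

lemma det_coordGram_pos {x p : M} (hp : p ∈ (chartAt (EuclideanSpace ℝ (Fin n)) x).source) :
    0 < (coordGram (n := n) x p).det := by
  rw [coordGram_eq_gram hp]
  exact (posDef_gram_basis _).det_pos

lemma inv_coordGram_symm (x p : M) (i j : Fin n) :
    (coordGram x p)⁻¹ i j = (coordGram x p)⁻¹ j i := by
  have h : (coordGram (n := n) x p).transpose = coordGram x p := by
    ext i j
    exact coordGram_symm x p j i
  conv_rhs => rw [← h, ← Matrix.transpose_nonsing_inv, Matrix.transpose_apply]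

variable [IsContMDiffRiemannianBundle (𝓡 n) ∞ (EuclideanSpace ℝ (Fin n))
      (fun x : M ↦ TangentSpace (𝓡 n) x)]

lemma contMDiffOn_coordGram (x : M) (i j : Fin n) :
    ContMDiffOn (𝓡 n) 𝓘(ℝ, ℝ) ∞ (fun p ↦ coordGram x p i j)
      (chartAt (EuclideanSpace ℝ (Fin n)) x).source :=
  ContMDiffOn.inner_bundle (E := fun x : M ↦ TangentSpace (𝓡 n) x)
    ((isLocalFrameOn_coordFrame x).contMDiffOn i) ((isLocalFrameOn_coordFrame x).contMDiffOn j)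

lemma contMDiffOn_det_coordGram (x : M) :
    ContMDiffOn (𝓡 n) 𝓘(ℝ, ℝ) ∞ (fun p ↦ (coordGram (n := n) x p).det)
      (chartAt (EuclideanSpace ℝ (Fin n)) x).source :=
  contMDiffOn_det (contMDiffOn_coordGram x)

lemma contMDiffOn_inv_coordGram (x : M) (i j : Fin n) :
    ContMDiffOn (𝓡 n) 𝓘(ℝ, ℝ) ∞ (fun p ↦ (coordGram x p)⁻¹ i j)
      (chartAt (EuclideanSpace ℝ (Fin n)) x).source :=
  contMDiffOn_inv (contMDiffOn_coordGram x) (fun _ hp ↦ (det_coordGram_pos hp).ne') i j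

lemma contMDiffOn_sqrt_det_coordGram (x : M) :
    ContMDiffOn (𝓡 n) 𝓘(ℝ, ℝ) ∞ (fun p ↦ √(coordGram (n := n) x p).det)
      (chartAt (EuclideanSpace ℝ (Fin n)) x).source := fun p hp ↦
  (Real.contDiffAt_sqrt (det_coordGram_pos hp).ne').contMDiffAt.comp_contMDiffWithinAt p
    (contMDiffOn_det_coordGram x p hp)

lemma coordDeriv_mul {x p : M} (i : Fin n) {f g : M → ℝ}
    (hf : MDifferentiableAt (𝓡 n) 𝓘(ℝ, ℝ) f p) (hg : MDifferentiableAt (𝓡 n) 𝓘(ℝ, ℝ) g p) :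
    coordDeriv x i (fun q ↦ f q * g q) p
      = f p * coordDeriv x i g p + g p * coordDeriv x i f p := by
  have := mvfderiv_mul hf hg
  change mvfderiv _ (f * g) p _ = _
  rw [this]
  simp [coordDeriv]

lemma coordDeriv_det_coordGram {x p : M}
    (hp : p ∈ (chartAt (EuclideanSpace ℝ (Fin n)) x).source) (k : Fin n) :
    coordDeriv x k (fun q ↦ (coordGram (n := n) x q).det) p
      = (coordGram (n := n) x p).det * ∑ i, ∑ j, (coordGram (n := n) x p)⁻¹ i j
          * coordDeriv x k (fun q ↦ coordGram (n := n) x q i j) p := by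
  have hS := (chartAt (EuclideanSpace ℝ (Fin n)) x).open_source.mem_nhds hp
  set φ := extChartAt (𝓡 n) x
  have hp' : p ∈ φ.source := by rwa [extChartAt_source]
  have hG (i j : Fin n) : MDifferentiableAt (𝓡 n) 𝓘(ℝ, ℝ) (fun q ↦ coordGram x q i j) p :=
    ((contMDiffOn_coordGram (n := n) x i j).contMDiffAt hS).mdifferentiableAt (by simp)
  have hd (i j : Fin n) : HasFDerivAt (fun y ↦ coordGram x (φ.symm y) i j)
      (fderiv ℝ ((fun q ↦ coordGram x q i j) ∘ φ.symm) (φ p)) (φ p) := by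
    exact (differentiableAt_comp_extChartAt_symm hp (hG i j)).hasFDerivAt
  have h := hasFDerivAt_det_comp hd
  rw [coordDeriv_eq_fderiv hp k
    (((contMDiffOn_det_coordGram (n := n) x).contMDiffAt hS).mdifferentiableAt (by simp))]
  have h' := h.fderiv
  change fderiv ℝ ((fun q ↦ (coordGram (n := n) x q).det) ∘ φ.symm) (φ p) = _ at h'
  rw [h', φ.left_inv hp']
  simp only [_root_.sum_apply, _root_.smul_apply, smul_eq_mul, Finset.mul_sum]
  refine Finset.sum_congr rfl fun i _ ↦ Finset.sum_congr rfl fun j _ ↦ ?_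
  rw [coordDeriv_eq_fderiv hp k (hG i j), inv_coordGram_symm, Matrix.inv_def, Matrix.smul_apply,
    Ring.inverse_eq_inv', smul_eq_mul, ← mul_assoc, ← mul_assoc,
    mul_inv_cancel₀ (det_coordGram_pos hp).ne', one_mul]

lemma coordDeriv_sqrt_det_coordGram {x p : M}
    (hp : p ∈ (chartAt (EuclideanSpace ℝ (Fin n)) x).source) (k : Fin n) :
    coordDeriv x k (fun q ↦ √(coordGram (n := n) x q).det) p
      = √(coordGram (n := n) x p).det * ((∑ i, ∑ j, (coordGram (n := n) x p)⁻¹ i j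
          * coordDeriv x k (fun q ↦ coordGram (n := n) x q i j) p) / 2) := by
  have hS := (chartAt (EuclideanSpace ℝ (Fin n)) x).open_source.mem_nhds hp
  have hd := det_coordGram_pos hp
  have hs : MDifferentiableAt (𝓡 n) 𝓘(ℝ, ℝ) (fun q ↦ √(coordGram (n := n) x q).det) p :=
    ((contMDiffOn_sqrt_det_coordGram (n := n) x).contMDiffAt hS).mdifferentiableAt (by simp)
  -- The product rule for `det = √det * √det` gives `∂ det = 2 √det ∂√det`; comparing with Jacobi's
  -- formula and cancelling the positive root isolates `∂√det`.
  have h₁ : coordDeriv x k (fun q ↦ (coordGram (n := n) x q).det) p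
      = coordDeriv x k
        (fun q ↦ √(coordGram (n := n) x q).det * √(coordGram (n := n) x q).det) p := by
    have : (fun q ↦ (coordGram (n := n) x q).det) =ᶠ[nhds p]
        fun q ↦ √(coordGram (n := n) x q).det * √(coordGram (n := n) x q).det := by
      filter_upwards [hS] with q hq
      rw [Real.mul_self_sqrt (det_coordGram_pos hq).le]
    simp only [coordDeriv, mvfderiv, this.mfderiv_eq]
    rfl
  rw [coordDeriv_mul k hs hs, coordDeriv_det_coordGram hp] at h₁
  have h₂ : 0 < √(coordGram (n := n) x p).det := Real.sqrt_pos.2 hd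
  have h₃ := Real.mul_self_sqrt hd.le
  refine mul_left_cancel₀ h₂.ne' ?_
  generalize (∑ i, ∑ j, (coordGram (n := n) x p)⁻¹ i j
          * coordDeriv x k (fun q ↦ coordGram (n := n) x q i j) p) = s at *
  linear_combination -(1/2) * h₁ - s / 2 * h₃

end Metric

/-! ### Gradient, Hessian, Laplacian and divergence in coordinates. -/

section Divergence

variable {n : ℕ} {M : Type*} [TopologicalSpace M] [ChartedSpace (EuclideanSpace ℝ (Fin n)) M]
  [RiemannianBundle (fun x : M ↦ TangentSpace (𝓡 n) x)]
  [IsManifold (𝓡 n) ∞ M]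

lemma inner_grad (f : M → ℝ) (p : M) (v : TangentSpace (𝓡 n) p) :
    inner ℝ (grad (𝓡 n) f p) v = mvfderiv (𝓡 n) f p v :=
  InnerProductSpace.toDual_symm_apply

/-- The `k`-th component of the gradient of `f` in the coordinate frame of the preferred chart
at `x`. -/
def gradCoeff (x : M) (f : M → ℝ) (k : Fin n) (p : M) : ℝ :=
  ∑ j : Fin n, (coordGram x p)⁻¹ k j * coordDeriv x j f p

lemma sum_gradCoeff_mul_coordGram {x p : M}
    (hp : p ∈ (chartAt (EuclideanSpace ℝ (Fin n)) x).source) (f : M → ℝ) (i : Fin n) :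
    ∑ k : Fin n, gradCoeff x f k p * coordGram x p k i = coordDeriv x i f p := by
  have hdet : IsUnit (coordGram (n := n) x p).det := (det_coordGram_pos hp).ne'.isUnit
  have h : (coordGram x p).mulVec ((coordGram x p)⁻¹.mulVec fun j ↦ coordDeriv x j f p) i
      = coordDeriv x i f p := by
    rw [Matrix.mulVec_mulVec, Matrix.mul_nonsing_inv _ hdet, Matrix.one_mulVec]
  rw [← h, Matrix.mulVec, dotProduct]
  refine Finset.sum_congr rfl fun k _ ↦ ?_
  rw [coordGram_symm, mul_comm]
  rfl

lemma grad_eq_sum {x p : M} (hp : p ∈ (chartAt (EuclideanSpace ℝ (Fin n)) x).source)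
    (f : M → ℝ) :
    grad (𝓡 n) f p = ∑ k : Fin n, gradCoeff x f k p • coordFrame x k p := by
  refine InnerProductSpace.ext_inner_right_basis
    ((isLocalFrameOn_coordFrame (n := n) x).toBasisAt hp) fun i ↦ ?_
  rw [inner_grad, IsLocalFrameOn.toBasisAt_coe, sum_inner]
  simp only [inner_smul_left, RCLike.conj_to_real]
  exact (sum_gradCoeff_mul_coordGram hp f i).symm

variable [IsContMDiffRiemannianBundle (𝓡 n) ∞ (EuclideanSpace ℝ (Fin n))
      (fun x : M ↦ TangentSpace (𝓡 n) x)]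

lemma contMDiffOn_gradCoeff (x : M) {f : M → ℝ} (k : Fin n)
    (hf : ContMDiffOn (𝓡 n) 𝓘(ℝ, ℝ) ∞ f (chartAt (EuclideanSpace ℝ (Fin n)) x).source) :
    ContMDiffOn (𝓡 n) 𝓘(ℝ, ℝ) ∞ (gradCoeff x f k)
      (chartAt (EuclideanSpace ℝ (Fin n)) x).source :=
  contMDiffOn_finsetSum fun j _ ↦ (contMDiffOn_inv_coordGram x k j).mul (contMDiffOn_coordDeriv j hf)

/-- The Christoffel symbols of the first kind `⟪∇_{e_i} e_k, e_j⟫`. -/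
def christoffel (x : M) (i k j : Fin n) (p : M) : ℝ :=
  (coordDeriv x i (fun q ↦ coordGram x q k j) p + coordDeriv x k (fun q ↦ coordGram x q i j) p
    - coordDeriv x j (fun q ↦ coordGram x q i k) p) / 2

lemma mdifferentiableAt_coordFrame {x p : M}
    (hp : p ∈ (chartAt (EuclideanSpace ℝ (Fin n)) x).source) (i : Fin n) :
    MDifferentiableAt (𝓡 n) ((𝓡 n).prod 𝓘(ℝ, EuclideanSpace ℝ (Fin n))) (T% (coordFrame (n := n) x i)) p :=
  ((isLocalFrameOn_coordFrame (n := n) x).contMDiffAt (chartAt _ x).open_source hp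
    i).mdifferentiableAt (by simp)

/-- With vanishing brackets, only the three derivatives of the metric survive in the Koszul formula.
-/
lemma inner_leviCivita_coordFrame {x p : M}
    (hp : p ∈ (chartAt (EuclideanSpace ℝ (Fin n)) x).source) (i k j : Fin n) :
    inner ℝ (leviCivita (𝓡 n) M (coordFrame x k) p (coordFrame x i p)) (coordFrame x j p)
      = christoffel x i k j p := by
  have h := inner_leviCivitaFun (I := 𝓡 n) (mdifferentiableAt_coordFrame hp i)
    (mdifferentiableAt_coordFrame hp k) (mdifferentiableAt_coordFrame hp j)
  refine h.trans ?_
  rw [koszul, mlieBracket_coordFrame hp, mlieBracket_coordFrame hp, mlieBracket_coordFrame hp,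
    inner_fun_comm (coordFrame x j) (coordFrame x i)]
  simp only [inner_zero_left, add_zero, sub_zero]
  rfl

lemma leviCivita_sum {ι : Type*} (s : Finset ι) {X : ι → Π p : M, TangentSpace (𝓡 n) p} {p : M}
    (h : ∀ i ∈ s, MDifferentiableAt (𝓡 n) ((𝓡 n).prod 𝓘(ℝ, EuclideanSpace ℝ (Fin n))) (T% (X i)) p) :
    leviCivita (𝓡 n) M (fun q ↦ ∑ i ∈ s, X i q) p = ∑ i ∈ s, leviCivita (𝓡 n) M (X i) p := by
  classical
  induction s using Finset.induction_on with
  | empty =>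
    simp only [Finset.sum_empty]
    exact congrFun (leviCivita (𝓡 n) M).zero p
  | insert a s ha ih =>
    have hs : ∀ i ∈ s, MDifferentiableAt (𝓡 n) ((𝓡 n).prod 𝓘(ℝ, EuclideanSpace ℝ (Fin n))) (T% (X i)) p := fun i hi ↦ h i (Finset.mem_insert_of_mem hi)
    simp only [Finset.sum_insert ha]
    rw [← ih hs]
    exact (leviCivita (𝓡 n) M).isCovariantDerivativeOnUniv.add (h a (Finset.mem_insert_self _ _))
      (MDifferentiableAt.sum_section hs)

/-- The components of the Hessian of `f` in a coordinate frame. -/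
def hessianCoeff (x : M) (f : M → ℝ) (i j : Fin n) (p : M) : ℝ :=
  ∑ k : Fin n, (coordDeriv x i (gradCoeff x f k) p * coordGram x p k j
    + gradCoeff x f k p * christoffel x i k j p)

lemma inner_hessian_coordFrame {x p : M}
    (hp : p ∈ (chartAt (EuclideanSpace ℝ (Fin n)) x).source) {f : M → ℝ}
    (hf : ContMDiffOn (𝓡 n) 𝓘(ℝ, ℝ) ∞ f (chartAt (EuclideanSpace ℝ (Fin n)) x).source)
    (i j : Fin n) :
    inner ℝ (hessian (𝓡 n) f p (coordFrame x i p)) (coordFrame x j p)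
      = hessianCoeff x f i j p := by
  have hS := (chartAt (EuclideanSpace ℝ (Fin n)) x).open_source.mem_nhds hp
  have hX (k : Fin n) : MDifferentiableAt (𝓡 n) 𝓘(ℝ, ℝ) (gradCoeff x f k) p :=
    ((contMDiffOn_gradCoeff x k hf).contMDiffAt hS).mdifferentiableAt (by simp)
  have hXe (k : Fin n) : MDifferentiableAt (𝓡 n) ((𝓡 n).prod 𝓘(ℝ, EuclideanSpace ℝ (Fin n))) (T% (gradCoeff x f k • coordFrame (n := n) x k)) p :=
    (hX k).smul_section (mdifferentiableAt_coordFrame hp k)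
  have hsum : MDifferentiableAt (𝓡 n) ((𝓡 n).prod 𝓘(ℝ, EuclideanSpace ℝ (Fin n))) (T% (fun q ↦ ∑ k : Fin n, (gradCoeff x f k • coordFrame (n := n) x k) q)) p :=
    MDifferentiableAt.sum_section fun k _ ↦ hXe k
  have hev : ∀ᶠ q in nhds p,
      grad (𝓡 n) f q = ∑ k : Fin n, (gradCoeff x f k • coordFrame (n := n) x k) q := by
    filter_upwards [hS] with q hq
    exact grad_eq_sum hq f
  have h : hessian (𝓡 n) f p
      = ∑ k : Fin n, leviCivita (𝓡 n) M (gradCoeff x f k • coordFrame (n := n) x k) p := by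
    rw [← leviCivita_sum _ fun k _ ↦ hXe k]
    -- A covariant derivative at `p` sees only the germ of the field, so the expansion of the
    -- gradient on the chart domain suffices.
    refine (leviCivita (𝓡 n) M).isCovariantDerivativeOnUniv.congr_of_eventuallyEq ?_ hsum ?_ hev
    · refine hsum.congr_of_eventuallyEq ?_
      filter_upwards [hev] with q hq
      rw [hq]
    · exact Filter.univ_mem
  rw [h, _root_.sum_apply, sum_inner, hessianCoeff]
  refine Finset.sum_congr rfl fun k _ ↦ ?_
  have hl : leviCivita (𝓡 n) M (gradCoeff x f k • coordFrame (n := n) x k) p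
      = gradCoeff x f k p • leviCivita (𝓡 n) M (coordFrame (n := n) x k) p
        + (mvfderiv (𝓡 n) (gradCoeff x f k) p).smulRight (coordFrame x k p) :=
    (leviCivita (𝓡 n) M).isCovariantDerivativeOnUniv.leibniz
      (mdifferentiableAt_coordFrame hp k) (hX k)
  rw [hl, _root_.add_apply, _root_.smul_apply, ContinuousLinearMap.smulRight_apply,
    inner_add_left, inner_smul_left, inner_smul_left, inner_leviCivita_coordFrame hp, add_comm]
  rfl

lemma contMDiffOn_christoffel (x : M) (i k j : Fin n) :
    ContMDiffOn (𝓡 n) 𝓘(ℝ, ℝ) ∞ (christoffel x i k j)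
      (chartAt (EuclideanSpace ℝ (Fin n)) x).source := by
  have h (a b c : Fin n) := contMDiffOn_coordDeriv (n := n) a (contMDiffOn_coordGram x b c)
  exact (((h i k j).add (h k i j)).sub (h j i k)).div_const 2

lemma contMDiffOn_hessianCoeff (x : M) {f : M → ℝ}
    (hf : ContMDiffOn (𝓡 n) 𝓘(ℝ, ℝ) ∞ f (chartAt (EuclideanSpace ℝ (Fin n)) x).source)
    (i j : Fin n) :
    ContMDiffOn (𝓡 n) 𝓘(ℝ, ℝ) ∞ (hessianCoeff x f i j)
      (chartAt (EuclideanSpace ℝ (Fin n)) x).source :=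
  contMDiffOn_finsetSum fun k _ ↦
    ((contMDiffOn_coordDeriv i (contMDiffOn_gradCoeff x k hf)).mul
      (contMDiffOn_coordGram x k j)).add
      ((contMDiffOn_gradCoeff x k hf).mul (contMDiffOn_christoffel x i k j))

/-- The Laplacian of `f`, the trace of its Hessian. -/
def laplacian (f : M → ℝ) (p : M) : ℝ :=
  LinearMap.trace ℝ (TangentSpace (𝓡 n) p)
    (hessian (𝓡 n) f p : TangentSpace (𝓡 n) p →ₗ[ℝ] TangentSpace (𝓡 n) p)

lemma laplacian_eq_sum_hessianCoeff {x p : M}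
    (hp : p ∈ (chartAt (EuclideanSpace ℝ (Fin n)) x).source) {f : M → ℝ}
    (hf : ContMDiffOn (𝓡 n) 𝓘(ℝ, ℝ) ∞ f (chartAt (EuclideanSpace ℝ (Fin n)) x).source) :
    laplacian (n := n) f p = ∑ i : Fin n, ∑ j : Fin n, (coordGram x p)⁻¹ i j * hessianCoeff x f i j p := by
  rw [laplacian, trace_eq_trace_inv_gram_mul ((isLocalFrameOn_coordFrame (n := n) x).toBasisAt hp),
    ← coordGram_eq_gram, Matrix.trace]
  refine Finset.sum_congr rfl fun i _ ↦ ?_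
  rw [Matrix.diag_apply, Matrix.mul_apply]
  refine Finset.sum_congr rfl fun j _ ↦ ?_
  rw [Matrix.of_apply, IsLocalFrameOn.toBasisAt_coe, IsLocalFrameOn.toBasisAt_coe,
    real_inner_comm, ← inner_hessian_coordFrame hp hf]
  rfl

/-- Needed for regularity only: the right-hand side is visibly smooth on the chart domain. -/
lemma normSqEnd_hessian_eq_sum {x p : M}
    (hp : p ∈ (chartAt (EuclideanSpace ℝ (Fin n)) x).source) {f : M → ℝ}
    (hf : ContMDiffOn (𝓡 n) 𝓘(ℝ, ℝ) ∞ f (chartAt (EuclideanSpace ℝ (Fin n)) x).source) :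
    normSqEnd (hessian (𝓡 n) f p) = ∑ i : Fin n, ∑ j : Fin n,
      (∑ k : Fin n, (coordGram x p)⁻¹ i k * hessianCoeff x f k j p)
        * ∑ k : Fin n, (coordGram x p)⁻¹ j k * hessianCoeff x f i k p := by
  rw [normSqEnd_eq_trace ((isLocalFrameOn_coordFrame (n := n) x).toBasisAt hp),
    ← coordGram_eq_gram, Matrix.trace]
  refine Finset.sum_congr rfl fun i _ ↦ ?_
  rw [Matrix.diag_apply, Matrix.mul_apply]
  refine Finset.sum_congr rfl fun j _ ↦ ?_
  rw [Matrix.mul_apply, Matrix.mul_apply]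
  congr 1 <;> refine Finset.sum_congr rfl fun k _ ↦ ?_
  · rw [Matrix.transpose_apply, Matrix.of_apply, IsLocalFrameOn.toBasisAt_coe,
      IsLocalFrameOn.toBasisAt_coe, real_inner_comm, ← inner_hessian_coordFrame hp hf]
  · rw [Matrix.of_apply, IsLocalFrameOn.toBasisAt_coe,
      IsLocalFrameOn.toBasisAt_coe, real_inner_comm, ← inner_hessian_coordFrame hp hf]

lemma contMDiff_of_contMDiffOn_chart_source {h : M → ℝ}
    (H : ∀ x, ContMDiffOn (𝓡 n) 𝓘(ℝ, ℝ) ∞ h (chartAt (EuclideanSpace ℝ (Fin n)) x).source) :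
    ContMDiff (𝓡 n) 𝓘(ℝ, ℝ) ∞ h := fun x ↦
  (H x).contMDiffAt ((chartAt _ x).open_source.mem_nhds (mem_chart_source _ x))

lemma contMDiff_laplacian {f : M → ℝ} (hf : ContMDiff (𝓡 n) 𝓘(ℝ, ℝ) ∞ f) :
    ContMDiff (𝓡 n) 𝓘(ℝ, ℝ) ∞ (laplacian (n := n) f) :=
  contMDiff_of_contMDiffOn_chart_source fun x ↦ ContMDiffOn.congr
    (contMDiffOn_finsetSum fun i _ ↦ contMDiffOn_finsetSum fun j _ ↦
      (contMDiffOn_inv_coordGram x i j).mul (contMDiffOn_hessianCoeff x hf.contMDiffOn i j))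
    fun _ hp ↦ laplacian_eq_sum_hessianCoeff hp hf.contMDiffOn

lemma contMDiff_normSqEnd_hessian {f : M → ℝ} (hf : ContMDiff (𝓡 n) 𝓘(ℝ, ℝ) ∞ f) :
    ContMDiff (𝓡 n) 𝓘(ℝ, ℝ) ∞ (fun p ↦ normSqEnd (hessian (𝓡 n) f p)) :=
  contMDiff_of_contMDiffOn_chart_source fun x ↦ ContMDiffOn.congr
    (contMDiffOn_finsetSum fun i _ ↦ contMDiffOn_finsetSum fun j _ ↦
      (contMDiffOn_finsetSum fun k _ ↦
        (contMDiffOn_inv_coordGram x i k).mul (contMDiffOn_hessianCoeff x hf.contMDiffOn k j)).mul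
      (contMDiffOn_finsetSum fun k _ ↦
        (contMDiffOn_inv_coordGram x j k).mul (contMDiffOn_hessianCoeff x hf.contMDiffOn i k)))
    fun _ hp ↦ normSqEnd_hessian_eq_sum hp hf.contMDiffOn

lemma contMDiff_grad {f : M → ℝ} (hf : ContMDiff (𝓡 n) 𝓘(ℝ, ℝ) ∞ f) :
    ContMDiff (𝓡 n) ((𝓡 n).prod 𝓘(ℝ, EuclideanSpace ℝ (Fin n))) ∞ (T% (grad (𝓡 n) f)) := by
  intro x
  have hS := (chartAt (EuclideanSpace ℝ (Fin n)) x).open_source.mem_nhds (mem_chart_source _ x)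
  have h : ContMDiffAt (𝓡 n) ((𝓡 n).prod 𝓘(ℝ, EuclideanSpace ℝ (Fin n))) ∞
      (T% (fun q ↦ ∑ k : Fin n, (gradCoeff x f k • coordFrame (n := n) x k) q)) x :=
    ContMDiffAt.sum_section fun k _ ↦
      ((contMDiffOn_gradCoeff x k hf.contMDiffOn).contMDiffAt hS).smul_section
      ((isLocalFrameOn_coordFrame (n := n) x).contMDiffAt (chartAt _ x).open_source
        (mem_chart_source _ x) k)
  refine h.congr_of_eventuallyEq ?_
  filter_upwards [hS] with q hq
  rw [grad_eq_sum hq f]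
  rfl

/-- The trace of the Hessian in a coordinate frame, with the Christoffel symbols contracted. -/
lemma laplacian_eq_sum {x p : M}
    (hp : p ∈ (chartAt (EuclideanSpace ℝ (Fin n)) x).source) {f : M → ℝ}
    (hf : ContMDiffOn (𝓡 n) 𝓘(ℝ, ℝ) ∞ f (chartAt (EuclideanSpace ℝ (Fin n)) x).source) :
    laplacian (n := n) f p = ∑ k : Fin n, (coordDeriv x k (gradCoeff x f k) p
      + gradCoeff x f k p * ((∑ i : Fin n, ∑ j : Fin n, (coordGram (n := n) x p)⁻¹ i j
          * coordDeriv x k (fun q ↦ coordGram (n := n) x q i j) p) / 2)) := by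
  have hdet : IsUnit (coordGram (n := n) x p).det := (det_coordGram_pos hp).ne'.isUnit
  have h₁ (i k : Fin n) : ∑ j : Fin n, (coordGram x p)⁻¹ i j * coordGram x p k j
      = if i = k then 1 else 0 := by
    have := congrFun₂ (Matrix.nonsing_inv_mul _ hdet) i k
    rw [Matrix.mul_apply, Matrix.one_apply] at this
    rw [← this]
    exact Finset.sum_congr rfl fun j _ ↦ by rw [coordGram_symm x p k j]
  have h₂ (k : Fin n) : ∑ i : Fin n, ∑ j : Fin n, (coordGram x p)⁻¹ i j * christoffel x i k j p
      = (∑ i : Fin n, ∑ j : Fin n, (coordGram (n := n) x p)⁻¹ i j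
          * coordDeriv x k (fun q ↦ coordGram (n := n) x q i j) p) / 2 := by
    -- By symmetry of the inverse metric, the first and third terms of the Christoffel symbol cancel
    -- under contraction. What remains is the logarithmic derivative of `√(det G)`.
    have hswap : ∑ i : Fin n, ∑ j : Fin n, (coordGram x p)⁻¹ i j * coordDeriv x i (fun q ↦ coordGram x q k j) p
        = ∑ i : Fin n, ∑ j : Fin n, (coordGram x p)⁻¹ i j * coordDeriv x j (fun q ↦ coordGram x q i k) p := by
      rw [Finset.sum_comm]
      refine Finset.sum_congr rfl fun i _ ↦ Finset.sum_congr rfl fun j _ ↦ ?_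
      rw [inv_coordGram_symm]
      simp only [coordGram_symm x _ k i]
    have : ∑ i : Fin n, ∑ j : Fin n, (coordGram x p)⁻¹ i j * christoffel x i k j p
        = (∑ i : Fin n, ∑ j : Fin n, (coordGram x p)⁻¹ i j * coordDeriv x i (fun q ↦ coordGram x q k j) p
          + ∑ i : Fin n, ∑ j : Fin n, (coordGram x p)⁻¹ i j * coordDeriv x k (fun q ↦ coordGram x q i j) p
          - ∑ i : Fin n, ∑ j : Fin n, (coordGram x p)⁻¹ i j * coordDeriv x j (fun q ↦ coordGram x q i k) p)
            / 2 := by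
      simp only [← Finset.sum_add_distrib, ← Finset.sum_sub_distrib, Finset.sum_div, christoffel]
      refine Finset.sum_congr rfl fun i _ ↦ Finset.sum_congr rfl fun j _ ↦ ?_
      ring
    rw [this, hswap, add_sub_cancel_left]
  rw [laplacian_eq_sum_hessianCoeff hp hf]
  calc ∑ i : Fin n, ∑ j : Fin n, (coordGram x p)⁻¹ i j * hessianCoeff x f i j p
      = ∑ k : Fin n, ∑ i : Fin n, (coordDeriv x i (gradCoeff x f k) p
            * (∑ j : Fin n, (coordGram x p)⁻¹ i j * coordGram x p k j)
          + gradCoeff x f k p * ∑ j : Fin n, (coordGram x p)⁻¹ i j * christoffel x i k j p) := by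
        conv_rhs => rw [Finset.sum_comm]
        refine Finset.sum_congr rfl fun i _ ↦ ?_
        simp only [hessianCoeff, Finset.mul_sum, ← Finset.sum_add_distrib]
        rw [Finset.sum_comm]
        refine Finset.sum_congr rfl fun k _ ↦ Finset.sum_congr rfl fun j _ ↦ ?_
        ring
    _ = _ := by
        refine Finset.sum_congr rfl fun k _ ↦ ?_
        rw [Finset.sum_add_distrib, ← Finset.mul_sum, h₂]
        simp [h₁]

/-- The divergence of `w • grad f` in a coordinate frame. -/
lemma sqrt_det_mul_divergence {x p : M}
    (hp : p ∈ (chartAt (EuclideanSpace ℝ (Fin n)) x).source) {f w : M → ℝ}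
    (hf : ContMDiffOn (𝓡 n) 𝓘(ℝ, ℝ) ∞ f (chartAt (EuclideanSpace ℝ (Fin n)) x).source)
    (hw : MDifferentiableAt (𝓡 n) 𝓘(ℝ, ℝ) w p) :
    √(coordGram (n := n) x p).det
        * (mvfderiv (𝓡 n) w p (grad (𝓡 n) f p) + w p * laplacian (n := n) f p)
      = ∑ k : Fin n, coordDeriv x k
        (fun q ↦ w q * (√(coordGram (n := n) x q).det * gradCoeff x f k q)) p := by
  have hS := (chartAt (EuclideanSpace ℝ (Fin n)) x).open_source.mem_nhds hp
  have hX (k : Fin n) : MDifferentiableAt (𝓡 n) 𝓘(ℝ, ℝ) (gradCoeff x f k) p :=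
    ((contMDiffOn_gradCoeff x k hf).contMDiffAt hS).mdifferentiableAt (by simp)
  have hs : MDifferentiableAt (𝓡 n) 𝓘(ℝ, ℝ) (fun q ↦ √(coordGram (n := n) x q).det) p :=
    ((contMDiffOn_sqrt_det_coordGram (n := n) x).contMDiffAt hS).mdifferentiableAt (by simp)
  rw [laplacian_eq_sum hp hf, grad_eq_sum hp f, map_sum, Finset.mul_sum,
    ← Finset.sum_add_distrib, Finset.mul_sum]
  refine Finset.sum_congr rfl fun k _ ↦ ?_
  have hsX : MDifferentiableAt (𝓡 n) 𝓘(ℝ, ℝ)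
    (fun q ↦ √(coordGram (n := n) x q).det * gradCoeff x f k q) p := hs.mul (hX k)
  rw [coordDeriv_mul k hw hsX, coordDeriv_mul k hs (hX k),
    coordDeriv_sqrt_det_coordGram hp, map_smul, smul_eq_mul]
  change _ * (_ * coordDeriv x k w p + _) = _
  ring

end Divergence

/-! ### The volume measure in charts. -/

section ChartVolume

variable {n : ℕ} {M : Type*} [TopologicalSpace M] [ChartedSpace (EuclideanSpace ℝ (Fin n)) M]
  [RiemannianBundle (fun x : M ↦ TangentSpace (𝓡 n) x)]
  [IsManifold (𝓡 n) ∞ M]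

lemma coordVector_eq_coordFrame {x : M} {y : EuclideanSpace ℝ (Fin n)}
    (hy : y ∈ (extChartAt (𝓡 n) x).target) (i : Fin n) :
    coordVector x y i = coordFrame x i ((extChartAt (𝓡 n) x).symm y) := by
  have hp := extChartAt_symm_mem_source hy
  have hinv := isInvertible_mfderiv_extChartAt (I := 𝓡 n) (x := x)
    ((extChartAt (𝓡 n) x).map_target hy)
  refine hinv.injective ?_
  rw [mfderiv_extChartAt_coordFrame hp]
  have h := mfderiv_extChartAt_comp_mfderivWithin_extChartAt_symm hy
  rw [ModelWithCorners.range_eq_univ, mfderivWithin_univ] at h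
  exact DFunLike.congr_fun h (EuclideanSpace.single i (1 : ℝ) : EuclideanSpace ℝ (Fin n))

lemma metricMatrix_eq_coordGram {x : M} {y : EuclideanSpace ℝ (Fin n)}
    (hy : y ∈ (extChartAt (𝓡 n) x).target) :
    metricMatrix x y = coordGram x ((extChartAt (𝓡 n) x).symm y) := by
  ext i j
  rw [metricMatrix, Matrix.of_apply, coordVector_eq_coordFrame hy, coordVector_eq_coordFrame hy]
  rfl

/-- The Riemannian density changes by the Jacobian determinant of the change of coordinates. -/
lemma sqrt_det_coordGram_eq {x x' p : M}
    (hp : p ∈ (chartAt (EuclideanSpace ℝ (Fin n)) x).source)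
    (hp' : p ∈ (chartAt (EuclideanSpace ℝ (Fin n)) x').source) :
    √(coordGram (n := n) x p).det
      = |(fderiv ℝ (extChartAt (𝓡 n) x' ∘ (extChartAt (𝓡 n) x).symm)
          (extChartAt (𝓡 n) x p)).det| * √(coordGram (n := n) x' p).det := by
  set T := fderiv ℝ (extChartAt (𝓡 n) x' ∘ (extChartAt (𝓡 n) x).symm) (extChartAt (𝓡 n) x p)
  let b := (EuclideanSpace.basisFun (Fin n) ℝ).toBasis
  let J := LinearMap.toMatrix b b (T : EuclideanSpace ℝ (Fin n) →ₗ[ℝ] EuclideanSpace ℝ (Fin n))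
  have hφ' : MDifferentiableAt (𝓡 n) 𝓘(ℝ, EuclideanSpace ℝ (Fin n)) (extChartAt (𝓡 n) x') p :=
    mdifferentiableAt_extChartAt hp'
  have hframe (i : Fin n) : coordFrame x i p = ∑ k, J k i • coordFrame x' k p := by
    have hinv := isInvertible_mfderiv_extChartAt (I := 𝓡 n) (x := x') (y := p)
      (by rwa [extChartAt_source])
    refine hinv.injective ?_
    rw [map_sum, mfderiv_coordFrame hp i hφ']
    simp only [map_smul]
    rw [Finset.sum_congr rfl fun k _ ↦ congrArg (J k i • ·) (mfderiv_extChartAt_coordFrame hp' k)]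
    change T (EuclideanSpace.single i 1)
      = ∑ k, J k i • (EuclideanSpace.single k (1 : ℝ) : EuclideanSpace ℝ (Fin n))
    have := b.sum_repr (T (EuclideanSpace.single i 1))
    rw [← this]
    refine Finset.sum_congr rfl fun k _ ↦ ?_
    simp [J, b, LinearMap.toMatrix_apply]
  -- The metric is a bilinear form, so it transforms by congruence with the Jacobian; its
  -- determinant acquires the factor `(det T)²`, whose root is `|det T|`.
  have hG : coordGram (n := n) x p = J.transpose * coordGram x' p * J := by
    ext i j
    rw [coordGram, Matrix.of_apply, hframe, hframe, sum_inner]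
    simp only [inner_sum, inner_smul_left, inner_smul_right, Matrix.mul_apply,
      Matrix.transpose_apply, Finset.sum_mul, RCLike.conj_to_real]
    rw [Finset.sum_comm]
    refine Finset.sum_congr rfl fun k _ ↦ Finset.sum_congr rfl fun l _ ↦ ?_
    simp only [coordGram, Matrix.of_apply]
    ring
  have hJ : J.det = T.det := by
    rw [ContinuousLinearMap.det, ← LinearMap.det_toMatrix b]
  rw [hG, Matrix.det_mul, Matrix.det_mul, Matrix.det_transpose, hJ,
    show T.det * (coordGram (n := n) x' p).det * T.det
      = T.det ^ 2 * (coordGram (n := n) x' p).det by ring,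
    Real.sqrt_mul (sq_nonneg _), Real.sqrt_sq_eq_abs]

variable [MeasurableSpace M] [BorelSpace M]

lemma aemeasurable_extChartAt_symm (x : M) :
    AEMeasurable (extChartAt (𝓡 n) x).symm
      (volume.restrict (extChartAt (𝓡 n) x).target) :=
  (continuousOn_extChartAt_symm x).aemeasurable (isOpen_extChartAt_target x).measurableSet

lemma chartVolume_apply (x : M) {B : Set M} (hB : MeasurableSet B) :
    chartVolume (n := n) x B
      = ∫⁻ y in (extChartAt (𝓡 n) x).symm ⁻¹' B ∩ (extChartAt (𝓡 n) x).target,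
        ENNReal.ofReal (√(coordGram (n := n) x ((extChartAt (𝓡 n) x).symm y)).det) := by
  have hm := (isOpen_extChartAt_target (I := 𝓡 n) x).measurableSet
  have hae := (aemeasurable_extChartAt_symm (n := n) x)
  rw [chartVolume, Measure.map_apply_of_aemeasurable
    (hae.mono_ac (withDensity_absolutelyContinuous _ _)) hB, withDensity_apply' _ _,
    Measure.restrict_restrict' hm]
  -- The inverse chart is only known to be a.e. measurable on the target, which gives
  -- null-measurability of the preimage.
  have hm' : NullMeasurableSet ((extChartAt (𝓡 n) x).symm ⁻¹' B ∩ (extChartAt (𝓡 n) x).target)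
      (volume : Measure (EuclideanSpace ℝ (Fin n))) := by
    exact (nullMeasurableSet_restrict hm.nullMeasurableSet).1 (hae.nullMeasurableSet_preimage hB)
  refine lintegral_congr_ae ?_
  filter_upwards [ae_restrict_mem₀ hm'] with y hy
  rw [metricMatrix_eq_coordGram hy.2]

lemma chartVolume_compl_source (x : M) :
    chartVolume (n := n) x (chartAt (EuclideanSpace ℝ (Fin n)) x).sourceᶜ = 0 := by
  rw [chartVolume_apply x (chartAt (EuclideanSpace ℝ (Fin n)) x).open_source.measurableSet.compl]
  have : (extChartAt (𝓡 n) x).symm ⁻¹' (chartAt (EuclideanSpace ℝ (Fin n)) x).sourceᶜ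
      ∩ (extChartAt (𝓡 n) x).target = ∅ := by
    ext y
    simp only [Set.mem_inter_iff, Set.mem_preimage, Set.mem_compl_iff, Set.mem_empty_iff_false,
      iff_false, not_and]
    exact fun h hy ↦ h (extChartAt_symm_mem_source hy)
  rw [this, setLIntegral_empty]

/-- Two chart measures agree on the overlap of the charts. -/
lemma chartVolume_eq_of_subset {x x' : M} {B : Set M} (hB : MeasurableSet B)
    (h : B ⊆ (chartAt (EuclideanSpace ℝ (Fin n)) x).source)
    (h' : B ⊆ (chartAt (EuclideanSpace ℝ (Fin n)) x').source) :
    chartVolume (n := n) x' B = chartVolume (n := n) x B := by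
  rw [chartVolume_apply x' hB, chartVolume_apply x hB]
  set φ := extChartAt (𝓡 n) x
  set φ' := extChartAt (𝓡 n) x'
  have hs : φ.source = (chartAt (EuclideanSpace ℝ (Fin n)) x).source := extChartAt_source _ _
  have hs' : φ'.source = (chartAt (EuclideanSpace ℝ (Fin n)) x').source := extChartAt_source _ _
  have himage : (φ' ∘ φ.symm) '' (φ.symm ⁻¹' B ∩ φ.target) = φ'.symm ⁻¹' B ∩ φ'.target := by
    ext y
    constructor
    · rintro ⟨z, ⟨hzB, hz⟩, rfl⟩
      refine ⟨?_, φ'.map_source (hs' ▸ h' hzB)⟩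
      rw [Set.mem_preimage, Function.comp_apply, φ'.left_inv (hs' ▸ h' hzB)]
      exact hzB
    · rintro ⟨hyB, hy⟩
      have hys : φ'.symm y ∈ φ.source := hs ▸ h hyB
      refine ⟨φ (φ'.symm y), ⟨?_, φ.map_source hys⟩, ?_⟩
      · rw [Set.mem_preimage, φ.left_inv hys]
        exact hyB
      · rw [Function.comp_apply, φ.left_inv hys, φ'.right_inv hy]
  have hm : MeasurableSet (φ.symm ⁻¹' B ∩ φ.target) := by
    have hc : Measurable fun y : φ.target ↦ φ.symm y :=
      (continuousOn_extChartAt_symm x).comp_continuous continuous_subtype_val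
        (fun y ↦ y.2) |>.measurable
    convert (isOpen_extChartAt_target (I := 𝓡 n) x).measurableSet.subtype_image (hc hB) using 1
    ext y
    simp [and_comm, φ]
  have hinj : Set.InjOn (φ' ∘ φ.symm) (φ.symm ⁻¹' B ∩ φ.target) := by
    rintro y ⟨hyB, hy⟩ z ⟨hzB, hz⟩ hyz
    exact φ.symm.injOn hy hz (φ'.injOn (hs' ▸ h' hyB) (hs' ▸ h' hzB) hyz)
  -- Change of variables along the transition map; its Jacobian factor is the one relating the two
  -- densities.
  rw [← himage, lintegral_image_eq_lintegral_abs_det_fderiv_mul volume hm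
    (f' := fun y ↦ fderiv ℝ (φ' ∘ φ.symm) y) ?_ hinj]
  · refine setLIntegral_congr_fun hm fun y hy ↦ ?_
    have := sqrt_det_coordGram_eq (h hy.1) (h' hy.1)
    rw [φ.right_inv hy.2] at this
    simp only [Function.comp_apply]
    rw [φ'.left_inv (hs' ▸ h' hy.1), this, ENNReal.ofReal_mul (abs_nonneg _)]
  · intro y hy
    have := differentiableAt_comp_extChartAt_symm (h hy.1)
      (mdifferentiableAt_extChartAt (I := 𝓡 n) (h' hy.1))
    rw [φ.right_inv hy.2] at this
    exact this.hasFDerivAt.hasFDerivWithinAt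

/-- The chart measures agree on overlaps, so on this chart domain no other chart measure exceeds its
own, and the supremum is attained there. -/
lemma restrict_riemannianVolume (x : M) :
    (riemannianVolume n M).restrict (chartAt (EuclideanSpace ℝ (Fin n)) x).source
      = chartVolume (n := n) x := by
  set S := (chartAt (EuclideanSpace ℝ (Fin n)) x).source
  have hS : MeasurableSet S := (chartAt (EuclideanSpace ℝ (Fin n)) x).open_source.measurableSet
  have hle (x' : M) : chartVolume (n := n) x' ≤ riemannianVolume n M :=
    le_iSup (fun x ↦ chartVolume (n := n) x) x'
  have hinter (x' : M) (A : Set M) :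
      chartVolume (n := n) x' (A ∩ (chartAt (EuclideanSpace ℝ (Fin n)) x').source)
        = chartVolume (n := n) x' A :=
    measure_inter_conull (chartVolume_compl_source x')
  -- A supremum of measures is bounded by exhibiting one measure above all of them. This candidate
  -- dominates each chart measure on `S` by agreement and off `S` trivially.
  have hub : riemannianVolume n M ≤ chartVolume (n := n) x + (riemannianVolume n M).restrict Sᶜ := by
    refine iSup_le fun x' ↦ Measure.le_iff.2 fun A hA ↦ ?_
    rw [Measure.add_apply, Measure.restrict_apply hA, ← measure_inter_add_sdiff A hS]
    refine add_le_add ?_ (hle x' _)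
    rw [← hinter x', chartVolume_eq_of_subset (x := x) (x' := x')
      ((hA.inter hS).inter (chartAt _ x').open_source.measurableSet)
      (Set.inter_subset_left.trans Set.inter_subset_right) Set.inter_subset_right]
    exact measure_mono (Set.inter_subset_left.trans Set.inter_subset_left)
  refine le_antisymm ?_ ?_
  · refine Measure.le_iff.2 fun A hA ↦ ?_
    rw [Measure.restrict_apply hA]
    refine (hub _).trans ?_
    rw [Measure.add_apply, Measure.restrict_apply (hA.inter hS)]
    have : A ∩ S ∩ Sᶜ = ∅ := by simp [Set.inter_assoc]
    rw [this, measure_empty, add_zero]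
    exact measure_mono Set.inter_subset_left
  · refine Measure.le_iff.2 fun A hA ↦ ?_
    rw [Measure.restrict_apply hA, ← hinter x]
    exact hle x _

variable [IsContMDiffRiemannianBundle (𝓡 n) ∞ (EuclideanSpace ℝ (Fin n))
      (fun x : M ↦ TangentSpace (𝓡 n) x)]

lemma continuousOn_sqrt_det_coordGram (x : M) :
    ContinuousOn (fun y ↦ √(coordGram (n := n) x ((extChartAt (𝓡 n) x).symm y)).det)
      (extChartAt (𝓡 n) x).target :=
  (contMDiffOn_sqrt_det_coordGram x).continuousOn.comp (continuousOn_extChartAt_symm x)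
    fun _ hy ↦ extChartAt_symm_mem_source hy

/-- The density is continuous, hence bounded on a compact coordinate neighbourhood. Local finiteness
is what makes continuous functions on a compact manifold integrable. -/
instance isLocallyFiniteMeasure_riemannianVolume :
    IsLocallyFiniteMeasure (riemannianVolume n M) where
  finiteAtNhds x := by
    set φ := extChartAt (𝓡 n) x
    have hs : φ.source = (chartAt (EuclideanSpace ℝ (Fin n)) x).source := extChartAt_source _ _
    obtain ⟨K, hK, hKt, hKc⟩ := local_compact_nhds (extChartAt_target_mem_nhds (I := 𝓡 n) x)
    refine ⟨φ.source ∩ φ ⁻¹' interior K, ?_, ?_⟩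
    · exact Filter.inter_mem (extChartAt_source_mem_nhds x)
        ((continuousAt_extChartAt x).preimage_mem_nhds (interior_mem_nhds.2 hK))
    · have hopen : IsOpen (φ.source ∩ φ ⁻¹' interior K) :=
        (continuousOn_extChartAt x).isOpen_inter_preimage (isOpen_extChartAt_source x)
          isOpen_interior
      have h₁ : riemannianVolume n M (φ.source ∩ φ ⁻¹' interior K)
          = chartVolume (n := n) x (φ.source ∩ φ ⁻¹' interior K) := by
        rw [← restrict_riemannianVolume x, Measure.restrict_apply hopen.measurableSet, ← hs,
          Set.inter_right_comm, Set.inter_self]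
      rw [h₁, chartVolume_apply x hopen.measurableSet]
      have h₂ : φ.symm ⁻¹' (φ.source ∩ φ ⁻¹' interior K) ∩ φ.target ⊆ K := by
        rintro y ⟨⟨-, hy⟩, hyt⟩
        rw [Set.mem_preimage, φ.right_inv hyt] at hy
        exact interior_subset hy
      refine (lintegral_mono_set h₂).trans_lt ?_
      exact (((continuousOn_sqrt_det_coordGram x).mono hKt).integrableOn_compact
        hKc).lintegral_lt_top

/-- The integral over a chart domain in coordinates. -/
lemma setIntegral_chart_source (x : M) {g : M → ℝ}
    (hg : AEStronglyMeasurable g (chartVolume (n := n) x)) :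
    ∫ p in (chartAt (EuclideanSpace ℝ (Fin n)) x).source, g p ∂(riemannianVolume n M)
      = ∫ y in (extChartAt (𝓡 n) x).target,
        √(coordGram (n := n) x ((extChartAt (𝓡 n) x).symm y)).det
          * g ((extChartAt (𝓡 n) x).symm y) := by
  have hm := (isOpen_extChartAt_target (I := 𝓡 n) x).measurableSet
  have hcongr : ∀ᵐ y ∂(volume.restrict (extChartAt (𝓡 n) x).target),
      √(metricMatrix x y).det = √(coordGram (n := n) x ((extChartAt (𝓡 n) x).symm y)).det := by
    filter_upwards [ae_restrict_mem hm] with y hy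
    rw [metricMatrix_eq_coordGram hy]
  have hd : AEMeasurable (fun y ↦ ENNReal.ofReal (√(metricMatrix (n := n) x y).det))
      (volume.restrict (extChartAt (𝓡 n) x).target) :=
    (((continuousOn_sqrt_det_coordGram x).aemeasurable hm).congr
      (hcongr.mono fun _ h ↦ h.symm)).ennreal_ofReal
  rw [restrict_riemannianVolume, chartVolume, integral_map
    ((aemeasurable_extChartAt_symm x).mono_ac (withDensity_absolutelyContinuous _ _)) hg,
    integral_withDensity_eq_integral_toReal_smul₀ hd
      (Filter.Eventually.of_forall fun _ ↦ ENNReal.ofReal_lt_top)]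
  refine integral_congr_ae ?_
  filter_upwards [hcongr] with y hy
  rw [hy, ENNReal.toReal_ofReal (Real.sqrt_nonneg _), smul_eq_mul]

end ChartVolume

/-! ### The divergence theorem on a closed manifold. -/

section IntegrationByParts

lemma integral_fderiv_apply_eq_zero {F : Type*} [NormedAddCommGroup F] [NormedSpace ℝ F]
    [FiniteDimensional ℝ F] [MeasurableSpace F] [BorelSpace F] (μ : Measure F)
    [μ.IsAddHaarMeasure] {g : F → ℝ} (hg : ContDiff ℝ 1 g) (hc : HasCompactSupport g) (v : F) :
    Integrable (fun y ↦ fderiv ℝ g y v) μ ∧ ∫ y, fderiv ℝ g y v ∂μ = 0 := by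
  have h₁ : Integrable (fun y ↦ fderiv ℝ g y v) μ :=
    ((hg.continuous_fderiv one_ne_zero).clm_apply continuous_const).integrable_of_hasCompactSupport
      (hc.fderiv_apply ℝ v)
  refine ⟨h₁, ?_⟩
  -- Integration by parts against the constant `1`, whose derivative vanishes.
  have h := integral_mul_fderiv_eq_neg_fderiv_mul_of_integrable (μ := μ) (f := fun _ : F ↦ (1 : ℝ))
    (g := g) (v := v) (by simp) (by simpa using h₁)
    (by simpa using hg.continuous.integrable_of_hasCompactSupport hc)
    (fun _ _ ↦ differentiableAt_const _) (fun y _ ↦ hg.differentiable one_ne_zero y)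
  simpa using h

variable {n : ℕ} {M : Type*} [TopologicalSpace M] [T2Space M] [CompactSpace M]
  [ChartedSpace (EuclideanSpace ℝ (Fin n)) M] [IsManifold (𝓡 n) ∞ M]

lemma integral_coordDeriv_eq_zero (x : M) (k : Fin n) {F : M → ℝ}
    (hF : ContMDiffOn (𝓡 n) 𝓘(ℝ, ℝ) ∞ F (chartAt (EuclideanSpace ℝ (Fin n)) x).source)
    (hs : tsupport F ⊆ (chartAt (EuclideanSpace ℝ (Fin n)) x).source) :
    IntegrableOn (fun y ↦ coordDeriv x k F ((extChartAt (𝓡 n) x).symm y))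
        (extChartAt (𝓡 n) x).target ∧
      ∫ y in (extChartAt (𝓡 n) x).target,
        coordDeriv x k F ((extChartAt (𝓡 n) x).symm y) = 0 := by
  set φ := extChartAt (𝓡 n) x
  have hS : φ.source = (chartAt (EuclideanSpace ℝ (Fin n)) x).source := extChartAt_source _ _
  have ht : IsOpen φ.target := isOpen_extChartAt_target x
  -- Extension by zero to the whole coordinate space. It is `C¹` with compact support because `K`,
  -- the image of the support of `F`, is a compact subset of the open target.
  set G := φ.target.indicator (F ∘ φ.symm)
  set K := φ '' tsupport F
  have hK : IsCompact K :=
    (isClosed_tsupport F).isCompact.image_of_continuousOn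
      ((continuousOn_extChartAt x).mono (hS ▸ hs))
  have hKt : K ⊆ φ.target := by
    rintro _ ⟨p, hp, rfl⟩
    exact φ.map_source (hS ▸ hs hp)
  have hG0 (y) (hy : y ∉ K) : G y = 0 := by
    by_cases hyt : y ∈ φ.target
    · refine (Set.indicator_of_mem hyt _).trans ?_
      exact image_eq_zero_of_notMem_tsupport (f := F) fun h ↦ hy ⟨_, h, φ.right_inv hyt⟩
    · exact Set.indicator_of_notMem hyt _
  have hGev (y) (hy : y ∈ φ.target) : G =ᶠ[nhds y] F ∘ φ.symm := by
    filter_upwards [ht.mem_nhds hy] with z hz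
    exact Set.indicator_of_mem hz _
  have hGev0 (y) (hy : y ∉ K) : G =ᶠ[nhds y] fun _ ↦ 0 := by
    filter_upwards [hK.isClosed.isOpen_compl.mem_nhds hy] with z hz
    exact hG0 z hz
  have hFs : ContDiffOn ℝ ∞ (F ∘ φ.symm) φ.target := by
    rw [← contMDiffOn_iff_contDiffOn]
    exact hF.comp (contMDiffOn_extChartAt_symm x) fun y hy ↦ extChartAt_symm_mem_source hy
  have hG : ContDiff ℝ 1 G := by
    refine contDiff_iff_contDiffAt.2 fun y ↦ ?_
    by_cases hy : y ∈ K
    · exact (((hFs.contDiffAt (ht.mem_nhds (hKt hy))).of_le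
        (by exact_mod_cast le_top)).congr_of_eventuallyEq (hGev y (hKt hy)))
    · exact contDiffAt_const.congr_of_eventuallyEq (hGev0 y hy)
  have hGc : HasCompactSupport G := HasCompactSupport.intro hK hG0
  obtain ⟨hi, h0⟩ := integral_fderiv_apply_eq_zero volume hG hGc (EuclideanSpace.single k (1 : ℝ))
  have hcongr : Set.EqOn (fun y ↦ coordDeriv x k F (φ.symm y))
      (fun y ↦ fderiv ℝ G y (EuclideanSpace.single k (1 : ℝ))) φ.target := by
    intro y hy
    have hp := extChartAt_symm_mem_source hy
    have := coordDeriv_eq_fderiv hp k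
      ((hF.contMDiffAt ((chartAt _ x).open_source.mem_nhds hp)).mdifferentiableAt (by simp))
    rw [φ.right_inv hy] at this
    simp only
    rw [this, (hGev y hy).fderiv_eq]
  refine ⟨(integrableOn_congr_fun hcongr ht.measurableSet).2 hi.integrableOn, ?_⟩
  rw [setIntegral_congr_fun ht.measurableSet hcongr, setIntegral_eq_integral_of_forall_compl_eq_zero,
    h0]
  intro y hy
  rw [(hGev0 y fun h ↦ hy (hKt h)).fderiv_eq]
  simp

variable [RiemannianBundle (fun x : M ↦ TangentSpace (𝓡 n) x)]
  [IsContMDiffRiemannianBundle (𝓡 n) ∞ (EuclideanSpace ℝ (Fin n))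
    (fun x : M ↦ TangentSpace (𝓡 n) x)]

/-- The divergence of `w • grad f`. -/
def divGrad (w f : M → ℝ) (p : M) : ℝ :=
  mvfderiv (𝓡 n) w p (grad (𝓡 n) f p) + w p * laplacian (n := n) f p

lemma continuous_divGrad {w f : M → ℝ} (hw : ContMDiff (𝓡 n) 𝓘(ℝ, ℝ) ∞ w)
    (hf : ContMDiff (𝓡 n) 𝓘(ℝ, ℝ) ∞ f) : Continuous (divGrad (n := n) w f) := by
  have h : Continuous fun p ↦ inner ℝ (grad (𝓡 n) w p) (grad (𝓡 n) f p) :=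
    (ContMDiff.inner_bundle (E := fun x : M ↦ TangentSpace (𝓡 n) x)
      (contMDiff_grad hw) (contMDiff_grad hf)).continuous
  simp only [inner_grad] at h
  exact h.add (hw.continuous.mul (contMDiff_laplacian hf).continuous)

variable [MeasurableSpace M] [BorelSpace M]

lemma integrable_of_continuous {h : M → ℝ} (hh : Continuous h) :
    Integrable h (riemannianVolume n M) :=
  hh.integrable_of_hasCompactSupport (HasCompactSupport.of_compactSpace h)

lemma integral_divGrad_eq_zero_of_tsupport_subset (x : M) {w f : M → ℝ}
    (hw : ContMDiff (𝓡 n) 𝓘(ℝ, ℝ) ∞ w) (hf : ContMDiff (𝓡 n) 𝓘(ℝ, ℝ) ∞ f)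
    (hs : tsupport w ⊆ (chartAt (EuclideanSpace ℝ (Fin n)) x).source) :
    ∫ p, divGrad (n := n) w f p ∂(riemannianVolume n M) = 0 := by
  have hoff (p : M) (hp : p ∉ (chartAt (EuclideanSpace ℝ (Fin n)) x).source) :
      divGrad (n := n) w f p = 0 := by
    have hp' : p ∉ tsupport w := fun h ↦ hp (hs h)
    have hev : w =ᶠ[nhds p] fun _ ↦ 0 := notMem_tsupport_iff_eventuallyEq.1 hp'
    have hd : mvfderiv (𝓡 n) w p = 0 := by
      have := mvfderiv_const (I := 𝓡 n) (0 : ℝ) (x := p)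
      rw [← this]
      simp only [mvfderiv, hev.mfderiv_eq]
      rw [hev.eq_of_nhds]
    rw [divGrad, hd, image_eq_zero_of_notMem_tsupport hp']
    simp
  -- The factor `w` confines the support to the chart; the density and the gradient components need
  -- only be smooth on the chart domain.
  have hterm (k : Fin n) := integral_coordDeriv_eq_zero x k
    (F := fun q ↦ w q * (√(coordGram (n := n) x q).det * gradCoeff x f k q))
    (hw.contMDiffOn.mul ((contMDiffOn_sqrt_det_coordGram x).mul
      (contMDiffOn_gradCoeff x k hf.contMDiffOn)))
    (tsupport_mul_subset_left.trans hs)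
  rw [← setIntegral_eq_integral_of_forall_compl_eq_zero hoff, setIntegral_chart_source x
    (continuous_divGrad hw hf).aestronglyMeasurable]
  calc _ = ∫ y in (extChartAt (𝓡 n) x).target, ∑ k, coordDeriv x k
        (fun q ↦ w q * (√(coordGram (n := n) x q).det * gradCoeff x f k q))
          ((extChartAt (𝓡 n) x).symm y) :=
        setIntegral_congr_fun (isOpen_extChartAt_target x).measurableSet fun y hy ↦
          sqrt_det_mul_divergence (extChartAt_symm_mem_source hy) hf.contMDiffOn
            (hw.mdifferentiableAt (by simp))
    _ = 0 := by
        rw [integral_finsetSum _ fun k _ ↦ (hterm k).1]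
        exact Finset.sum_eq_zero fun k _ ↦ (hterm k).2

lemma integral_divGrad_sum_eq_zero {ι : Type*} (s : Finset ι) {w : ι → M → ℝ} {f : M → ℝ}
    (hf : ContMDiff (𝓡 n) 𝓘(ℝ, ℝ) ∞ f) (hw : ∀ i, ContMDiff (𝓡 n) 𝓘(ℝ, ℝ) ∞ (w i))
    (h : ∀ i, ∫ p, divGrad (n := n) (w i) f p ∂(riemannianVolume n M) = 0) :
    ∫ p, divGrad (n := n) (fun q ↦ ∑ i ∈ s, w i q) f p ∂(riemannianVolume n M) = 0 := by
  classical
  induction s using Finset.induction_on with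
  | empty =>
    have (p : M) : divGrad (n := n) (fun _ ↦ (0 : ℝ)) f p = 0 := by
      simp [divGrad, mvfderiv_const]
    simp [this]
  | insert a s ha ih =>
    have hs : ContMDiff (𝓡 n) 𝓘(ℝ, ℝ) ∞ fun q ↦ ∑ i ∈ s, w i q :=
      contMDiff_finsetSum fun i _ ↦ hw i
    have hadd (p : M) : divGrad (n := n) (fun q ↦ ∑ i ∈ insert a s, w i q) f p
        = divGrad (n := n) (w a) f p + divGrad (n := n) (fun q ↦ ∑ i ∈ s, w i q) f p := by
      simp only [Finset.sum_insert ha, divGrad]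
      have := mvfderiv_add ((hw a).mdifferentiableAt (x := p) (by simp))
        (hs.mdifferentiableAt (x := p) (by simp))
      change mvfderiv (𝓡 n) (w a + fun q ↦ ∑ i ∈ s, w i q) p _ + _ = _
      rw [this, _root_.add_apply]
      ring
    simp only [hadd]
    rw [integral_add (integrable_of_continuous (continuous_divGrad (hw a) hf))
      (integrable_of_continuous (continuous_divGrad hs hf)), h a, ih, add_zero]

/-- The divergence theorem for `w • grad f` on a closed Riemannian manifold. -/
theorem integral_divGrad_eq_zero {w f : M → ℝ} (hw : ContMDiff (𝓡 n) 𝓘(ℝ, ℝ) ∞ w)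
    (hf : ContMDiff (𝓡 n) 𝓘(ℝ, ℝ) ∞ f) :
    ∫ p, divGrad (n := n) w f p ∂(riemannianVolume n M) = 0 := by
  -- A finite cover makes the partition of unity a finite sum, so integral and sum can be exchanged.
  obtain ⟨t, ht⟩ := isCompact_univ.elim_finite_subcover
    (fun x : M ↦ (chartAt (EuclideanSpace ℝ (Fin n)) x).source)
    (fun x ↦ (chartAt _ x).open_source)
    (fun x _ ↦ Set.mem_iUnion_of_mem x (mem_chart_source _ x))
  obtain ⟨ρ, hρ⟩ := SmoothPartitionOfUnity.exists_isSubordinate (𝓡 n) (isClosed_univ (X := M))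
    (fun x : t ↦ (chartAt (EuclideanSpace ℝ (Fin n)) (x : M)).source)
    (fun x ↦ (chartAt _ (x : M)).open_source) (by simpa [Set.iUnion_subtype] using ht)
  have hsum : w = fun q ↦ ∑ i : t, ρ i q * w q := by
    funext q
    have := ρ.sum_eq_one (Set.mem_univ q)
    rw [finsum_eq_sum_of_fintype] at this
    rw [← Finset.sum_mul, this, one_mul]
  have hρw (i : t) : ContMDiff (𝓡 n) 𝓘(ℝ, ℝ) ∞ fun q ↦ ρ i q * w q := (ρ i).contMDiff.mul hw
  rw [hsum]
  exact integral_divGrad_sum_eq_zero _ hf hρw fun i ↦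
    integral_divGrad_eq_zero_of_tsupport_subset (i : M) (hρw i) hf
      (tsupport_mul_subset_left.trans (hρ i))

end IntegrationByParts

/-! ### Pointwise identities and estimates for `f = log u`. -/

section LogHessian

variable {n : ℕ} {M : Type*} [TopologicalSpace M]
  [ChartedSpace (EuclideanSpace ℝ (Fin n)) M] [IsManifold (𝓡 n) ∞ M]
  [RiemannianBundle (fun x : M ↦ TangentSpace (𝓡 n) x)]

lemma grad_eq_smul_grad_log {u : M → ℝ} {p : M} (hu : MDifferentiableAt (𝓡 n) 𝓘(ℝ, ℝ) u p)
    (hp : 0 < u p) :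
    grad (𝓡 n) u p = u p • grad (𝓡 n) (fun q ↦ Real.log (u q)) p := by
  refine ext_inner_right ℝ fun v ↦ ?_
  rw [inner_smul_left, inner_grad, inner_grad, RCLike.conj_to_real]
  have hl : MDifferentiableAt 𝓘(ℝ, ℝ) 𝓘(ℝ, ℝ) Real.log (u p) :=
    (Real.differentiableAt_log hp.ne').mdifferentiableAt
  have h := mfderiv_comp_apply p hl hu v
  rw [mfderiv_eq_fderiv] at h
  have h' : mvfderiv (𝓡 n) (fun q ↦ Real.log (u q)) p v
      = fderiv ℝ Real.log (u p) (mvfderiv (𝓡 n) u p v) := h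
  rw [h', fderiv_eq_smul_deriv, Real.deriv_log, smul_eq_mul]
  field_simp

variable [IsContMDiffRiemannianBundle (𝓡 n) ∞ (EuclideanSpace ℝ (Fin n))
    (fun x : M ↦ TangentSpace (𝓡 n) x)]

/-- Metric compatibility of the connection. Symmetry of the Hessian plays no role, since the
direction of differentiation is the gradient itself. -/
lemma mvfderiv_inner_grad_self {f : M → ℝ} (hf : ContMDiff (𝓡 n) 𝓘(ℝ, ℝ) ∞ f) (p : M) :
    mvfderiv (𝓡 n) (fun q ↦ inner ℝ (grad (𝓡 n) f q) (grad (𝓡 n) f q)) p (grad (𝓡 n) f p)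
      = 2 * inner ℝ (hessian (𝓡 n) f p (grad (𝓡 n) f p)) (grad (𝓡 n) f p) := by
  have hg := (contMDiff_grad hf).mdifferentiableAt (x := p) (by simp)
  have h := leviCivita_metric hg hg hg
  rw [h, hessian, real_inner_comm (leviCivita (𝓡 n) M (grad (𝓡 n) f) p (grad (𝓡 n) f p))]
  ring

lemma divGrad_mul_normSq_grad_log {u : M → ℝ} (hu : ContMDiff (𝓡 n) 𝓘(ℝ, ℝ) ∞ u)
    (hpos : ∀ x, 0 < u x) {f : M → ℝ} (hlog : f = fun q ↦ Real.log (u q))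
    (hf : ContMDiff (𝓡 n) 𝓘(ℝ, ℝ) ∞ f) (p : M) :
    divGrad (n := n) (fun q ↦ u q * inner ℝ (grad (𝓡 n) f q) (grad (𝓡 n) f q)) f p
      = u p * (‖grad (𝓡 n) f p‖ ^ 4
        + 2 * inner ℝ (hessian (𝓡 n) f p (grad (𝓡 n) f p)) (grad (𝓡 n) f p)
        + ‖grad (𝓡 n) f p‖ ^ 2 * laplacian (n := n) f p) := by
  have hg : ContMDiff (𝓡 n) 𝓘(ℝ, ℝ) ∞
      fun q ↦ inner ℝ (grad (𝓡 n) f q) (grad (𝓡 n) f q) :=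
    ContMDiff.inner_bundle (E := fun x : M ↦ TangentSpace (𝓡 n) x)
      (contMDiff_grad hf) (contMDiff_grad hf)
  have hm := mvfderiv_mul (hu.mdifferentiableAt (x := p) (by simp))
    (hg.mdifferentiableAt (x := p) (by simp))
  have hgu := grad_eq_smul_grad_log (hu.mdifferentiableAt (x := p) (by simp)) (hpos p)
  rw [← hlog] at hgu
  have hdu : mvfderiv (𝓡 n) u p (grad (𝓡 n) f p) = u p * ‖grad (𝓡 n) f p‖ ^ 2 := by
    rw [← inner_grad, hgu, inner_smul_left, RCLike.conj_to_real, real_inner_self_eq_norm_sq]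
  rw [divGrad]
  change mvfderiv (𝓡 n) (u * fun q ↦ inner ℝ (grad (𝓡 n) f q) (grad (𝓡 n) f q)) p _ + _ = _
  rw [hm, _root_.add_apply, _root_.smul_apply, _root_.smul_apply, mvfderiv_inner_grad_self hf, hdu,
    real_inner_self_eq_norm_sq, smul_eq_mul, smul_eq_mul]
  ring

/-- Each Hessian term is allowed a quarter of `|∇f|⁴`, so that half of it can be absorbed later. The
price is `4 |∇²f|²` for the quadratic form and `(Δf)² ≤ n |∇²f|²` for the trace term. -/
lemma neg_hessian_terms_le (f : M → ℝ) (p : M) :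
    -(2 * inner ℝ (hessian (𝓡 n) f p (grad (𝓡 n) f p)) (grad (𝓡 n) f p)
        + ‖grad (𝓡 n) f p‖ ^ 2 * laplacian (n := n) f p)
      ≤ ‖grad (𝓡 n) f p‖ ^ 4 / 2 + (4 + n) * normSqEnd (hessian (𝓡 n) f p) := by
  set N := normSqEnd (hessian (𝓡 n) f p)
  have hN : 0 ≤ N := normSqEnd_nonneg _
  have h₁ := sq_inner_le_normSqEnd_mul (hessian (𝓡 n) f p) (grad (𝓡 n) f p)
  have h₂ : laplacian (n := n) f p ^ 2 ≤ n * N := by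
    have h := sq_trace_le_finrank_mul_normSqEnd (hessian (𝓡 n) f p)
    have hr : Module.finrank ℝ (TangentSpace (𝓡 n) p) = n := finrank_euclideanSpace_fin
    rwa [hr] at h
  set a := inner ℝ (hessian (𝓡 n) f p (grad (𝓡 n) f p)) (grad (𝓡 n) f p)
  set t := laplacian (n := n) f p
  set g := ‖grad (𝓡 n) f p‖ ^ 2
  have hg4 : ‖grad (𝓡 n) f p‖ ^ 4 = g ^ 2 := by simp only [g]; ring
  rw [hg4]
  -- From `a² ≤ N g²` and AM–GM for `g² / 4` and `4 N`, in squared form to avoid `√N`.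
  have h₃ : |2 * a| ≤ g ^ 2 / 4 + 4 * N := by
    refine abs_le_of_sq_le_sq ?_ (by positivity)
    nlinarith [sq_nonneg (g ^ 2 / 4 - 4 * N)]
  have h₄ := neg_le_of_abs_le h₃
  -- The square expands to `-g t ≤ g² / 4 + t²`.
  nlinarith [sq_nonneg (g / 2 + t)]

end LogHessian

/-! ### The integrated estimate. -/

section GradientEstimate

variable {n : ℕ} {M : Type*} [TopologicalSpace M] [T2Space M] [CompactSpace M]
  [ChartedSpace (EuclideanSpace ℝ (Fin n)) M] [IsManifold (𝓡 n) ∞ M]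
  [RiemannianBundle (fun x : M ↦ TangentSpace (𝓡 n) x)]
  [IsContMDiffRiemannianBundle (𝓡 n) ∞ (EuclideanSpace ℝ (Fin n))
    (fun x : M ↦ TangentSpace (𝓡 n) x)]
  [MeasurableSpace M] [BorelSpace M]

theorem integral_norm_grad_pow_four_div_le {u : M → ℝ} (hu : ContMDiff (𝓡 n) 𝓘(ℝ, ℝ) ∞ u)
    (hpos : ∀ x, 0 < u x) :
    Integrable (fun x ↦ ‖grad (𝓡 n) u x‖ ^ 4 / u x ^ 3) (riemannianVolume n M) ∧
      Integrable (fun x ↦ u x * normSqEnd (hessian (𝓡 n) (fun p ↦ Real.log (u p)) x))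
        (riemannianVolume n M) ∧
      ∫ x, ‖grad (𝓡 n) u x‖ ^ 4 / u x ^ 3 ∂(riemannianVolume n M)
        ≤ 2 * (4 + n) * ∫ x, u x * normSqEnd (hessian (𝓡 n) (fun p ↦ Real.log (u p)) x)
            ∂(riemannianVolume n M) := by
  have hf : ContMDiff (𝓡 n) 𝓘(ℝ, ℝ) ∞ fun q ↦ Real.log (u q) := fun p ↦
    (Real.contDiffAt_log.2 (hpos p).ne').contMDiffAt.comp p (hu p)
  obtain ⟨f, hlog⟩ : ∃ f : M → ℝ, f = fun q ↦ Real.log (u q) := ⟨_, rfl⟩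
  rw [← hlog] at hf ⊢
  have hg : ContMDiff (𝓡 n) 𝓘(ℝ, ℝ) ∞
      fun q ↦ inner ℝ (grad (𝓡 n) f q) (grad (𝓡 n) f q) :=
    ContMDiff.inner_bundle (E := fun x : M ↦ TangentSpace (𝓡 n) x)
      (contMDiff_grad hf) (contMDiff_grad hf)
  have hquot (p : M) : ‖grad (𝓡 n) u p‖ ^ 4 / u p ^ 3
      = u p * ‖grad (𝓡 n) f p‖ ^ 4 := by
    have := hpos p
    rw [grad_eq_smul_grad_log (hu.mdifferentiableAt (by simp)) this, ← hlog, norm_smul,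
      Real.norm_of_nonneg this.le]
    field_simp
  simp only [hquot]
  have hgc : Continuous fun p ↦ ‖grad (𝓡 n) f p‖ ^ 4 := by
    refine (hg.continuous.pow 2).congr fun p ↦ ?_
    rw [Pi.pow_apply, real_inner_self_eq_norm_sq]
    ring
  have hA : Integrable (fun p ↦ u p * ‖grad (𝓡 n) f p‖ ^ 4)
      (riemannianVolume n M) := integrable_of_continuous (hu.continuous.mul hgc)
  have hB : Integrable (fun p ↦ u p * normSqEnd (hessian (𝓡 n) f p)) (riemannianVolume n M) :=
    integrable_of_continuous (hu.continuous.mul (contMDiff_normSqEnd_hessian (n := n) hf).continuous)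
  refine ⟨hA, hB, ?_⟩
  have hw := hu.mul hg
  have hdiv := integral_divGrad_eq_zero (n := n) hw hf
  have hle : ∫ p, (u p * ‖grad (𝓡 n) f p‖ ^ 4 / 2
      -- This integrand lies pointwise below the divergence of `u |∇f|² ∇f`: half of `u |∇f|⁴` has
      -- already absorbed the Hessian terms. Clearing that half gives the factor `2` in the
      -- constant.
      - (4 + n) * (u p * normSqEnd (hessian (𝓡 n) f p))) ∂(riemannianVolume n M) ≤ 0 := by
    rw [← hdiv]
    refine integral_mono ((hA.div_const 2).sub (hB.const_mul _))
      (integrable_of_continuous (continuous_divGrad (n := n) hw hf)) fun p ↦ ?_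
    refine le_of_le_of_eq ?_ (divGrad_mul_normSq_grad_log hu hpos hlog hf p).symm
    have := mul_le_mul_of_nonneg_left (neg_hessian_terms_le (n := n) f p) (hpos p).le
    simp only
    linarith
  rw [integral_sub (hA.div_const 2) (hB.const_mul _), integral_div, integral_const_mul] at hle
  linarith

end GradientEstimate

end RiemannianGeometry

end

theorem proposition1p2 (n : ℕ) (M : Type*) [TopologicalSpace M] [T2Space M] [CompactSpace M]
    [ChartedSpace (EuclideanSpace ℝ (Fin n)) M] [IsManifold (𝓡 n) ∞ M]
    [RiemannianBundle (fun x : M ↦ TangentSpace (𝓡 n) x)]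
    [IsContMDiffRiemannianBundle (𝓡 n) ∞ (EuclideanSpace ℝ (Fin n))
      (fun x : M ↦ TangentSpace (𝓡 n) x)]
    [MeasurableSpace M] [BorelSpace M] :
    ∃ C : ℝ, 0 < C ∧ ∀ u : M → ℝ, ContMDiff (𝓡 n) 𝓘(ℝ, ℝ) ∞ u → (∀ x, 0 < u x) →
      Integrable (fun x ↦ ‖RiemannianGeometry.grad (𝓡 n) u x‖ ^ 4 / u x ^ 3)
        (RiemannianGeometry.riemannianVolume n M) ∧
      Integrable (fun x ↦ u x * RiemannianGeometry.normSqEnd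
          (RiemannianGeometry.hessian (𝓡 n) (fun p ↦ Real.log (u p)) x))
        (RiemannianGeometry.riemannianVolume n M) ∧
      ∫ x, ‖RiemannianGeometry.grad (𝓡 n) u x‖ ^ 4 / u x ^ 3
          ∂(RiemannianGeometry.riemannianVolume n M)
        ≤ C * ∫ x, u x * RiemannianGeometry.normSqEnd
            (RiemannianGeometry.hessian (𝓡 n) (fun p ↦ Real.log (u p)) x)
            ∂(RiemannianGeometry.riemannianVolume n M) :=
  ⟨2 * (4 + n), by positivity, fun _ hu hpos ↦
    RiemannianGeometry.integral_norm_grad_pow_four_div_le hu hpos⟩
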